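/- Let $(\Omega,\mathcal F,P)$ be a probability space with a filtration $(\mathcal F_t)_{0\le t\le T}$ such that $\mathcal F_0$ contains all $P$-null sets, and let $(S_t)_{0\le t\le T}$ be an adapted $\mathbb R^d$-valued process, $\Delta S_t:=S_t-S_{t-1}$. Let $\Xi_t$ be the set of $\mathcal F_t$-measurable $\mathbb R^d$-valued random variables and $\Phi$ the set of strategies $\phi=(\phi_t)_{1\le t\le T}$ with $\phi_t\in\Xi_{t-1}$; for $c\in\mathbb R$ put $V_t^{c,\phi}:=c+\sum_{i=1}^t\langle\phi_i,\Delta S_i\rangle$. Assume (NA) for every $\phi\in\Phi$: if $V_T^{0,\phi}\ge 0$ a.s., then $V_T^{0,\phi}=0$ a.s. Let $U:\mathbb R\to\mathbb R$ be concave and nondecreasing with $U(0)=0$, and suppose that at least one of the following holds: (a) there are $\tilde x>0$ and $0<\gamma<1$ with $U(\lambda x)\le\lambda^\gamma U(x)$ for all $x\ge\tilde x$, $\lambda\ge1$; (b) there are $\alpha>0$ and $\tilde x\le0$ with $U(\lambda x)\le\lambda^{1+\alpha}U(x)$ for all $x\le\tilde x$, $\lambda\ge1$. Let $B$ be a bounded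 random variable. (An expectation or conditional expectation of a random variable $X$ is understood in the generalized sense, as that of $X^+$ minus that of $X^-$, with values in $[-\infty,\infty]$; it is well defined if these two are not both infinite, almost surely in the conditional case.) Put $U_T(x):=U(x-B)$ and suppose that the random functions $$U_t(x):=\operatorname*{ess\,sup}_{\xi\in\Xi_t}E\bigl(U_{t+1}(x+\langle\xi,\Delta S_{t+1}\rangle)\,\big|\,\mathcal F_t\bigr),\qquad x\in\mathbb R,\ t=T-1,\dots,0,$$ are well defined (all the conditional expectations on the right are well defined, where for $U_{t+1}$, $t+1<T$, one takes a version with almost surely nondecreasing concave paths) and satisfy $U_t(x)<\infty$ a.s. for all $x\in\mathbb R$ and $0\le t<T$, and that $EU_0(x)<\infty$ for all $x\in\mathbb R$. Then for every $c\in\mathbb R$ there is a strategy $\phi^*=\phi^*(c)\in\Phi(U,c,B)$ such that $$u(B,c)=EU\bigl(V_T^{c,\phi^*}-B\bigr),\qquad -\infty<u(B,c)<\infty,$$ where $$u(B,c):=\sup_{\phi\in\Phi(U,c,B)}EU\bigl(V_T^{c,\phi}-B\bigr)$$ and $\Phi(U,c,B)$ is the set of $\phi\in\Phi$ for which the expectation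 $EU(V_T^{c,\phi}-B)$ is well defined. -/

import Mathlib

open MeasureTheory

namespace UtilityMax

/-! ### Generalized expectations and essential suprema -/

section Generalized

variable {Ω : Type*} {mΩ : MeasurableSpace Ω}

/-- The expectation `E X = E X⁺ - E X⁻` is well defined: `E X⁺` and `E X⁻` are not both infinite. -/
def ExpDefined (P : Measure Ω) (X : Ω → ℝ) : Prop :=
  ∫⁻ ω, ENNReal.ofReal (X ω) ∂P ≠ ⊤ ∨ ∫⁻ ω, ENNReal.ofReal (-X ω) ∂P ≠ ⊤

/-- The extended-real expectation `E X = E X⁺ - E X⁻` (meaningful when `ExpDefined P X`). -/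
noncomputable def genExp (P : Measure Ω) (X : Ω → ℝ) : EReal :=
  ((∫⁻ ω, ENNReal.ofReal (X ω) ∂P : ENNReal) : EReal) -
    ((∫⁻ ω, ENNReal.ofReal (-X ω) ∂P : ENNReal) : EReal)

/-- The generalized conditional expectation `E(X | m) = E(X⁺ | m) - E(X⁻ | m)` is well defined:
almost surely, `E(X⁺ | m)` and `E(X⁻ | m)` are not both infinite. -/
def CondExpDefined (P : Measure[mΩ] Ω) (m : MeasurableSpace Ω) (X : Ω → ℝ) : Prop :=
  ∀ᵐ ω ∂P, condLExp m P (fun ω' => ENNReal.ofReal (X ω')) ω ≠ ⊤ ∨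
    condLExp m P (fun ω' => ENNReal.ofReal (-X ω')) ω ≠ ⊤

/-- The generalized (extended-real valued) conditional expectation
`E(X | m) = E(X⁺ | m) - E(X⁻ | m)` (meaningful when `CondExpDefined P m X`). -/
noncomputable def genCondExp (P : Measure[mΩ] Ω) (m : MeasurableSpace Ω) (X : Ω → ℝ) : Ω → EReal :=
  fun ω => ((condLExp m P (fun ω' => ENNReal.ofReal (X ω')) ω : ENNReal) : EReal) -
    ((condLExp m P (fun ω' => ENNReal.ofReal (-X ω')) ω : ENNReal) : EReal)

/-- `Z` is a version of the essential supremum of the family `(f i)` of `m`-measurable extended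
random variables: it is `m`-measurable, it dominates every `f i` almost surely, and it is almost
surely below every random variable with that property. -/
def IsEssSup {ι : Type*} (P : Measure[mΩ] Ω) (m : MeasurableSpace Ω)
    (f : ι → Ω → EReal) (Z : Ω → EReal) : Prop :=
  Measurable[m] Z ∧ (∀ i, f i ≤ᵐ[P] Z) ∧
    ∀ Z' : Ω → EReal, Measurable[mΩ] Z' → (∀ i, f i ≤ᵐ[P] Z') → Z ≤ᵐ[P] Z'

end Generalized

/-! ### The market -/

section Market

variable {Ω : Type*} {mΩ : MeasurableSpace Ω} {d : ℕ}

/-- The set `Ξ_t` of `F_t`-measurable `d`-dimensional random variables. -/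
abbrev Xi (d : ℕ) (F : Filtration ℕ mΩ) (t : ℕ) : Type _ :=
  {ξ : Ω → EuclideanSpace ℝ (Fin d) // Measurable[F t] ξ}

/-- Trading strategies `(φ_t)`, `1 ≤ t ≤ T`: predictability means that `φ_{t+1}` is
`F_t`-measurable for `0 ≤ t < T`. The values of `φ` at other times are irrelevant. -/
def IsStrategy (F : Filtration ℕ mΩ) (T : ℕ) (φ : ℕ → Ω → EuclideanSpace ℝ (Fin d)) : Prop :=
  ∀ t, t < T → Measurable[F t] (φ (t + 1))

/-- The gain `⟨y, ΔS_{t+1}⟩` of a position `y` held from time `t` to time `t + 1`. -/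
noncomputable def gain (S : ℕ → Ω → EuclideanSpace ℝ (Fin d)) (t : ℕ)
    (y : EuclideanSpace ℝ (Fin d)) (ω : Ω) : ℝ :=
  inner ℝ y (S (t + 1) ω - S t ω)

/-- The portfolio value `V_t^{c,φ} = c + ∑_{i=1}^t ⟨φ_i, S_i - S_{i-1}⟩`. -/
noncomputable def wealth (S : ℕ → Ω → EuclideanSpace ℝ (Fin d)) (c : ℝ)
    (φ : ℕ → Ω → EuclideanSpace ℝ (Fin d)) (t : ℕ) (ω : Ω) : ℝ :=
  c + ∑ i ∈ Finset.range t, gain S i (φ (i + 1) ω) ω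

/-- Absence of arbitrage. -/
def NoArbitrage (P : Measure Ω) (F : Filtration ℕ mΩ) (T : ℕ)
    (S : ℕ → Ω → EuclideanSpace ℝ (Fin d)) : Prop :=
  ∀ φ : ℕ → Ω → EuclideanSpace ℝ (Fin d), IsStrategy F T φ →
    (∀ᵐ ω ∂P, 0 ≤ wealth S 0 φ T ω) → ∀ᵐ ω ∂P, wealth S 0 φ T ω = 0

/-! ### The dynamic value functions -/

/-- The family `ξ ↦ E(V(x + ⟨ξ, ΔS_{t+1}⟩) | F_t)`, `ξ ∈ Ξ_t`, for a random function `V`. -/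
noncomputable def condValue (P : Measure Ω) (F : Filtration ℕ mΩ)
    (S : ℕ → Ω → EuclideanSpace ℝ (Fin d)) (t : ℕ) (V : ℝ → Ω → ℝ) (x : ℝ)
    (ξ : Xi d F t) : Ω → EReal :=
  genCondExp P (F t) (fun ω => V (x + gain S t (ξ.1 ω) ω) ω)

/-- `IsValueFunction P F S T UT t V`: the random function `V` is a (regular version of) the value
function `U_t` obtained by backward recursion from the random terminal utility `U_T = UT`:
`U_t(x) = ess sup_{ξ ∈ Ξ_t} E(U_{t+1}(x + ⟨ξ, ΔS_{t+1}⟩) | F_t)` for every `x`.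
Since `U_{t+1}` is evaluated at a random point, versions whose paths are almost surely
nondecreasing and concave (hence continuous) are used; such a version is unique up to a null set.
That such versions exist is nowhere assumed. -/
inductive IsValueFunction (P : Measure Ω) (F : Filtration ℕ mΩ)
    (S : ℕ → Ω → EuclideanSpace ℝ (Fin d)) (T : ℕ) (UT : ℝ → Ω → ℝ) :
    ℕ → (ℝ → Ω → ℝ) → Prop
  | terminal : IsValueFunction P F S T UT T UT
  | step {t : ℕ} {V W : ℝ → Ω → ℝ} (ht : t < T)
      (hV : IsValueFunction P F S T UT (t + 1) V)
      (hreg : ∀ᵐ ω ∂P, Monotone (fun x => W x ω) ∧ ConcaveOn ℝ Set.univ (fun x => W x ω))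
      (hW : ∀ x, IsEssSup P (F t) (condValue P F S t V x) (fun ω => ((W x ω : ℝ) : EReal))) :
      IsValueFunction P F S T UT t W

/-- The value functions with random terminal utility `UT` are well defined and finite: at each
`0 ≤ t < T` and for each `x`, all the conditional expectations
`E(U_{t+1}(x + ⟨ξ, ΔS_{t+1}⟩) | F_t)`, `ξ ∈ Ξ_t`, are well defined and their essential supremum
`U_t(x)` is almost surely `< ∞`; moreover `E U_0(x) < ∞` for each `x`. -/
structure FiniteValueFunctions (P : Measure Ω) (F : Filtration ℕ mΩ)
    (S : ℕ → Ω → EuclideanSpace ℝ (Fin d)) (T : ℕ) (UT : ℝ → Ω → ℝ) : Prop where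
  defined : ∀ (t : ℕ) (V : ℝ → Ω → ℝ), t < T → IsValueFunction P F S T UT (t + 1) V →
    ∀ (x : ℝ) (ξ : Xi d F t), CondExpDefined P (F t) (fun ω => V (x + gain S t (ξ.1 ω) ω) ω)
  finite : ∀ (t : ℕ) (V : ℝ → Ω → ℝ), t < T → IsValueFunction P F S T UT (t + 1) V →
    ∀ (x : ℝ), ∃ Z : Ω → EReal, IsEssSup P (F t) (condValue P F S t V x) Z ∧ ∀ᵐ ω ∂P, Z ω < ⊤
  initial : ∀ V : ℝ → Ω → ℝ, IsValueFunction P F S T UT 0 V →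
    ∀ x : ℝ, ExpDefined P (V x) ∧ genExp P (V x) < ⊤

/-! ### Optimization with a contingent claim -/

/-- The set `Φ(U, c, B)` of the strategies `φ` for which `E U(V_T^{c,φ} - B)` is well defined. -/
def admissible (P : Measure Ω) (F : Filtration ℕ mΩ)
    (S : ℕ → Ω → EuclideanSpace ℝ (Fin d)) (T : ℕ) (U : ℝ → ℝ) (c : ℝ) (B : Ω → ℝ) :
    Set (ℕ → Ω → EuclideanSpace ℝ (Fin d)) :=
  {φ | IsStrategy F T φ ∧ ExpDefined P (fun ω => U (wealth S c φ T ω - B ω))}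

/-- The optimal value `u(B, c) = sup_{φ ∈ Φ(U, c, B)} E U(V_T^{c,φ} - B)`. -/
noncomputable def optimalValue (P : Measure Ω) (F : Filtration ℕ mΩ)
    (S : ℕ → Ω → EuclideanSpace ℝ (Fin d)) (T : ℕ) (U : ℝ → ℝ) (c : ℝ) (B : Ω → ℝ) : EReal :=
  ⨆ φ ∈ admissible P F S T U c B, genExp P (fun ω => U (wealth S c φ T ω - B ω))

end Market

/-! ### Utility functions -/

/-- A concave, nondecreasing utility function with `U(0) = 0`, whose growth at `+∞` is controlled:
`U(λx) ≤ λ^γ U(x)` for all `x ≥ x₀`, `λ ≥ 1`, for some `x₀ > 0` and `0 < γ < 1`. -/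
structure ElasticAtTop (U : ℝ → ℝ) : Prop where
  concave : ConcaveOn ℝ Set.univ U
  mono : Monotone U
  zero : U 0 = 0
  growth : ∃ x₀ : ℝ, 0 < x₀ ∧ ∃ γ : ℝ, 0 < γ ∧ γ < 1 ∧
    ∀ x, x₀ ≤ x → ∀ l : ℝ, 1 ≤ l → U (l * x) ≤ l ^ γ * U x

/-- A concave, nondecreasing utility function with `U(0) = 0`, whose growth at `-∞` is controlled:
`U(λx) ≤ λ^(1+α) U(x)` for all `x ≤ x₀`, `λ ≥ 1`, for some `α > 0` and `x₀ ≤ 0`. -/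
structure ElasticAtBot (U : ℝ → ℝ) : Prop where
  concave : ConcaveOn ℝ Set.univ U
  mono : Monotone U
  zero : U 0 = 0
  growth : ∃ α : ℝ, 0 < α ∧ ∃ x₀ : ℝ, x₀ ≤ 0 ∧
    ∀ x, x ≤ x₀ → ∀ l : ℝ, 1 ≤ l → U (l * x) ≤ l ^ (1 + α) * U x

end UtilityMax

namespace UtilityMax

set_option linter.unusedSectionVars false

/-! ### Generalized and real-valued conditional expectations -/

section CondExp

open scoped ENNReal

variable {Ω : Type*} {m mΩ : MeasurableSpace Ω} {P : Measure Ω} [IsProbabilityMeasure P]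

/-! The proof is dynamic programming: solve each one-period problem, check that its value function
has the same structure as the utility it came from, and glue the one-period optimizers together. The
structure is `RandomUtility`: concave nondecreasing paths, a deterministic lower bound, divergence
to `-∞`, and the scaling bounds `V(λx) ≤ λ^p (V(x) + C)` and `V(λx) ≤ λ^q (V(x) + C)` with `p < q`.
Both elasticity conditions lead to it, because concavity alone gives exponent `1`: condition (a)
supplies a smaller exponent and condition (b) a larger one. A constant `U` does not tend to `-∞` and
is treated separately.

The gap `p < q` is used twice. It first gives compactness (`OnePeriod.ae_bounded`). Suppose
positions of size `r → ∞` keep their conditional expected utility bounded below. The payoffs divided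
by `r^p` are dominated, while a losing limit direction would make them diverge to `-∞` like
`-r^(q-p)`; Fatou's lemma excludes this. Absence of arbitrage then forces the limit direction to
have zero gain, which is impossible for positions orthogonal to all zero-gain ones. Measurable
subsequences, upper semicontinuity and an exhaustion argument now give an optimizer from every
random wealth (`OnePeriod.exists_optimal_position`), and a regular version of the value function
that can be evaluated at random wealth (`OnePeriod.exists_isValue`). Scaling positions transfers the
growth bounds to the value, and the compactness argument also shows that the value tends to `-∞`.

The second use gives integrability (`OnePeriod.integrable_payoff_of_optimal`). Halving wealth and an
optimal position yields a payoff of at least `(2^(-p) - 2^(-q)) f⁺ + 2^(-q) f - C`, where `f` is the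
optimal payoff. The value at half the wealth bounds its conditional expectation, so `f⁺` is
integrable, and then so is `f`. Hence integrability passes forward from `U_0(c)` to the terminal
utility of the glued strategy, whose expected utility is exactly `E U_0(c)`; no admissible strategy
exceeds this. -/

/-- The measures with densities `X` and `E(X | m)` agree on `m`, so they integrate every
`m`-measurable function alike. -/
theorem condLExp_mul_left (hm : m ≤ mΩ) {r X : Ω → ℝ≥0∞} (hr : Measurable[m] r)
    (hX : Measurable X) :
    condLExp m P (fun ω => r ω * X ω) =ᵐ[P] fun ω => r ω * condLExp m P X ω := by
  refine (ae_eq_condLExp hm P _ (hr.mul (measurable_condLExp m P X)) fun s hs => ?_).symm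
  have htrim : (P.withDensity (condLExp m P X)).trim hm = (P.withDensity X).trim hm := by
    refine @Measure.ext _ m _ _ fun t ht => ?_
    rw [trim_measurableSet_eq hm ht, trim_measurableSet_eq hm ht, withDensity_apply _ (hm t ht),
      withDensity_apply _ (hm t ht), setLIntegral_condLExp hm P X ht]
  have key : ∀ Y : Ω → ℝ≥0∞, Measurable Y → ∫⁻ ω in s, r ω * Y ω ∂P =
      ∫⁻ ω, s.indicator r ω ∂((P.withDensity Y).trim hm) := by
    intro Y hY
    rw [lintegral_trim hm (hr.indicator hs), lintegral_withDensity_eq_lintegral_mul _ hY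
      ((hr.indicator hs).mono hm le_rfl), ← lintegral_indicator (hm s hs)]
    refine lintegral_congr fun ω => ?_
    by_cases h : ω ∈ s <;> simp [h, mul_comm]
  exact (key _ (measurable_condLExp' m P X)).trans (by rw [key _ hX, htrim])

theorem condLExp_le_of_setLIntegral_le (hm : m ≤ mΩ) {X D : Ω → ℝ≥0∞}
    (h : ∀ s, MeasurableSet[m] s → ∫⁻ ω in s, X ω ∂P ≤ ∫⁻ ω in s, D ω ∂P)
    (hD : Measurable[m] D) : condLExp m P X ≤ᵐ[P] D := by
  apply ae_le_of_ae_le_trim (hm := hm)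
  refine ae_le_of_forall_setLIntegral_le_of_sigmaFinite (measurable_condLExp m P X)
    fun s hs _ => ?_
  rw [setLIntegral_condLExp_trim hm _ _ hs, setLIntegral_trim hm hD hs]
  exact h s hs

/-- A conditional form of Fatou's lemma. -/
theorem condLExp_liminf_le (hm : m ≤ mΩ) {h : ℕ → Ω → ℝ≥0∞} (hh : ∀ n, Measurable (h n))
    {D : Ω → ℝ≥0∞} (hD : Measurable[m] D)
    (hle : ∀ᶠ n in Filter.atTop, condLExp m P (h n) ≤ᵐ[P] D) :
    condLExp m P (fun ω => Filter.liminf (fun n => h n ω) Filter.atTop) ≤ᵐ[P] D := by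
  refine condLExp_le_of_setLIntegral_le hm (fun s hs => ?_) hD
  refine (lintegral_liminf_le hh).trans ?_
  refine Filter.liminf_le_of_frequently_le' (Filter.Eventually.frequently ?_)
  filter_upwards [hle] with n hn
  rw [← setLIntegral_condLExp hm P (h n) hs]
  exact lintegral_mono_ae (ae_restrict_of_ae hn)

/-- On the `m`-measurable set where the conditional expectation is at most `n`, the integral of `X`
is at most `n`; these sets exhaust almost all of the space. -/
theorem ae_lt_top_of_condLExp_lt_top (hm : m ≤ mΩ) {X : Ω → ℝ≥0∞} (hX : Measurable X)
    (h : ∀ᵐ ω ∂P, condLExp m P X ω < ⊤) : ∀ᵐ ω ∂P, X ω < ⊤ := by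
  have hn : ∀ n : ℕ, ∀ᵐ ω ∂P, condLExp m P X ω ≤ n → X ω < ⊤ := by
    intro n
    have hs : MeasurableSet[m] {ω | condLExp m P X ω ≤ n} :=
      measurableSet_le (measurable_condLExp m P X) measurable_const
    have h1 : ∫⁻ ω in {ω | condLExp m P X ω ≤ n}, X ω ∂P ≠ ⊤ := by
      rw [← setLIntegral_condLExp hm P X hs]
      refine ne_top_of_le_ne_top (b := ∫⁻ ω, (n : ℝ≥0∞) ∂P) (by simp) ?_
      refine (setLIntegral_mono measurable_const (fun ω hω => hω)).trans ?_
      exact setLIntegral_le_lintegral _ _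
    have h2 := ae_lt_top hX h1
    rwa [ae_restrict_iff' (hm _ hs)] at h2
  filter_upwards [h, ae_all_iff.2 hn] with ω h1 h2
  obtain ⟨n, hn⟩ := ENNReal.exists_nat_gt h1.ne
  exact h2 n hn.le

/-- `f` is measurable and `E(|f| | m) < ∞` almost surely. -/
structure CondIntegrable {mΩ : MeasurableSpace Ω} (P : Measure[mΩ] Ω) (m : MeasurableSpace Ω)
    (f : Ω → ℝ) : Prop where
  meas : Measurable[mΩ] f
  fin : ∀ᵐ ω ∂P, condLExp m P (fun ω => ENNReal.ofReal |f ω|) ω < ⊤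

/-- The real-valued conditional expectation of a conditionally integrable random variable. -/
noncomputable def ce {mΩ : MeasurableSpace Ω} (P : Measure[mΩ] Ω) (m : MeasurableSpace Ω)
    (f : Ω → ℝ) : Ω → ℝ :=
  fun ω => (condLExp m P (fun ω => ENNReal.ofReal (f ω)) ω).toReal -
    (condLExp m P (fun ω => ENNReal.ofReal (-f ω)) ω).toReal

theorem measurable_ce (P : Measure[mΩ] Ω) (m : MeasurableSpace Ω) (f : Ω → ℝ) :
    Measurable[m] (ce P m f) :=
  (measurable_condLExp m P _).ennreal_toReal.sub (measurable_condLExp m P _).ennreal_toReal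

theorem CondIntegrable.pos_lt_top {f : Ω → ℝ} (hf : CondIntegrable P m f) :
    ∀ᵐ ω ∂P, condLExp m P (fun ω => ENNReal.ofReal (f ω)) ω < ⊤ := by
  filter_upwards [hf.fin, condLExp_mono (mΩ := m) (P := P) (X := fun ω => ENNReal.ofReal (f ω))
    (Y := fun ω => ENNReal.ofReal |f ω|)
    (ae_of_all _ fun ω => ENNReal.ofReal_le_ofReal (le_abs_self _))] with ω h1 h2
  exact h2.trans_lt h1

theorem CondIntegrable.neg_lt_top {f : Ω → ℝ} (hf : CondIntegrable P m f) :
    ∀ᵐ ω ∂P, condLExp m P (fun ω => ENNReal.ofReal (-f ω)) ω < ⊤ := by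
  filter_upwards [hf.fin, condLExp_mono (mΩ := m) (P := P) (X := fun ω => ENNReal.ofReal (-f ω))
    (Y := fun ω => ENNReal.ofReal |f ω|)
    (ae_of_all _ fun ω => ENNReal.ofReal_le_ofReal (neg_le_abs _))] with ω h1 h2
  exact h2.trans_lt h1

theorem condIntegrable_of_pos_neg {f : Ω → ℝ} (hf : Measurable f)
    (h1 : ∀ᵐ ω ∂P, condLExp m P (fun ω => ENNReal.ofReal (f ω)) ω < ⊤)
    (h2 : ∀ᵐ ω ∂P, condLExp m P (fun ω => ENNReal.ofReal (-f ω)) ω < ⊤) :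
    CondIntegrable P m f := by
  refine ⟨hf, ?_⟩
  have h3 := condLExp_add_left (mΩ := m) (P := P) (X := fun ω => ENNReal.ofReal (f ω))
    (fun ω => ENNReal.ofReal (-f ω)) hf.ennreal_ofReal.aemeasurable
  have h4 : (fun ω => ENNReal.ofReal |f ω|) =
      (fun ω => ENNReal.ofReal (f ω)) + fun ω => ENNReal.ofReal (-f ω) := by
    ext ω
    rcases le_total 0 (f ω) with h | h
    · simp [abs_of_nonneg h, ENNReal.ofReal_of_nonpos (neg_nonpos.2 h)]
    · simp [abs_of_nonpos h, ENNReal.ofReal_of_nonpos h]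
  rw [h4]
  filter_upwards [h1, h2, h3] with ω h1 h2 h3
  rw [h3]
  exact ENNReal.add_lt_top.2 ⟨h1, h2⟩

theorem CondIntegrable.mono {f g : Ω → ℝ} (hg : CondIntegrable P m g)
    (hf : Measurable f) (h : ∀ᵐ ω ∂P, |f ω| ≤ |g ω|) : CondIntegrable P m f := by
  refine ⟨hf, ?_⟩
  filter_upwards [hg.fin, condLExp_mono (mΩ := m) (P := P) (X := fun ω => ENNReal.ofReal |f ω|)
    (Y := fun ω => ENNReal.ofReal |g ω|)
    (by filter_upwards [h] with ω h using ENNReal.ofReal_le_ofReal h)] with ω h1 h2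
  exact h2.trans_lt h1

theorem CondIntegrable.add {f g : Ω → ℝ} (hf : CondIntegrable P m f) (hg : CondIntegrable P m g) :
    CondIntegrable P m (fun ω => f ω + g ω) := by
  refine ⟨hf.meas.add hg.meas, ?_⟩
  have h3 := condLExp_add_left (mΩ := m) (P := P) (X := fun ω => ENNReal.ofReal |f ω|)
    (fun ω => ENNReal.ofReal |g ω|) (hf.meas.abs.ennreal_ofReal.aemeasurable)
  have h4 := condLExp_mono (mΩ := m) (P := P) (X := fun ω => ENNReal.ofReal |f ω + g ω|)
    (Y := (fun ω => ENNReal.ofReal |f ω|) + fun ω => ENNReal.ofReal |g ω|)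
    (ae_of_all _ fun ω => by
      simp only [Pi.add_apply]
      rw [← ENNReal.ofReal_add (abs_nonneg _) (abs_nonneg _)]
      exact ENNReal.ofReal_le_ofReal (abs_add_le _ _))
  filter_upwards [hf.fin, hg.fin, h3, h4] with ω h1 h2 h3 h4
  refine h4.trans_lt ?_
  rw [h3]
  exact ENNReal.add_lt_top.2 ⟨h1, h2⟩

theorem CondIntegrable.mul_left (hm : m ≤ mΩ) {r f : Ω → ℝ} (hr : Measurable[m] r)
    (hf : CondIntegrable P m f) : CondIntegrable P m (fun ω => r ω * f ω) := by
  refine ⟨(hr.mono hm le_rfl).mul hf.meas, ?_⟩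
  have h := condLExp_mul_left (P := P) hm (r := fun ω => ENNReal.ofReal |r ω|)
    (X := fun ω => ENNReal.ofReal |f ω|) (by fun_prop) (hf.meas.abs.ennreal_ofReal)
  have h4 : (fun ω => ENNReal.ofReal |r ω * f ω|) =
    fun ω => ENNReal.ofReal |r ω| * ENNReal.ofReal |f ω| := by
    ext ω
    rw [abs_mul, ENNReal.ofReal_mul (abs_nonneg _)]
  rw [h4]
  filter_upwards [hf.fin, h] with ω h1 h2
  rw [h2]
  exact ENNReal.mul_lt_top ENNReal.ofReal_lt_top h1

theorem condIntegrable_of_measurable (hm : m ≤ mΩ) {f : Ω → ℝ} (hf : Measurable[m] f) :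
    CondIntegrable P m f := by
  refine ⟨hf.mono hm le_rfl, ?_⟩
  rw [condLExp_eq_self hm P (by fun_prop)]
  exact ae_of_all _ fun ω => ENNReal.ofReal_lt_top

theorem ce_of_measurable (hm : m ≤ mΩ) {f : Ω → ℝ} (hf : Measurable[m] f) : ce P m f = f := by
  ext ω
  rw [ce, condLExp_eq_self hm P (by fun_prop), condLExp_eq_self hm P (by fun_prop)]
  rcases le_total 0 (f ω) with h | h
  · simp [h, ENNReal.ofReal_of_nonpos (neg_nonpos.2 h)]
  · simp [h, ENNReal.ofReal_of_nonpos h]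

theorem CondIntegrable.neg {f : Ω → ℝ} (hf : CondIntegrable P m f) :
    CondIntegrable P m (fun ω => - f ω) :=
  ⟨hf.meas.neg, by simpa using hf.fin⟩

theorem ce_neg (f : Ω → ℝ) (ω : Ω) : ce P m (fun ω => - f ω) ω = - ce P m f ω := by
  simp [ce]

theorem CondIntegrable.sub {f g : Ω → ℝ} (hf : CondIntegrable P m f) (hg : CondIntegrable P m g) :
    CondIntegrable P m (fun ω => f ω - g ω) := by
  simpa [sub_eq_add_neg] using hf.add hg.neg

theorem ce_add {f g : Ω → ℝ} (hf : CondIntegrable P m f) (hg : CondIntegrable P m g) :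
    ce P m (fun ω => f ω + g ω) =ᵐ[P] fun ω => ce P m f ω + ce P m g ω := by
  have hfg := hf.add hg
  -- Positive and negative parts are arranged so that only sums occur, since subtraction in `ℝ≥0∞`
  -- truncates.
  have key : (fun ω => ENNReal.ofReal (f ω + g ω)) +
      ((fun ω => ENNReal.ofReal (-f ω)) + fun ω => ENNReal.ofReal (-g ω)) =
      (fun ω => ENNReal.ofReal (-(f ω + g ω))) +
      ((fun ω => ENNReal.ofReal (f ω)) + fun ω => ENNReal.ofReal (g ω)) := by
    ext ω
    simp only [Pi.add_apply]
    have e : ∀ x : ℝ, ENNReal.ofReal x = ENNReal.ofReal (max x 0) := fun x => by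
      rcases le_total 0 x with h | h <;> simp [h]
    rw [e (f ω + g ω), e (-f ω), e (-g ω), e (-(f ω + g ω)), e (f ω), e (g ω),
      ← ENNReal.ofReal_add (le_max_right _ _) (le_max_right _ _),
      ← ENNReal.ofReal_add (le_max_right _ _) (le_max_right _ _),
      ← ENNReal.ofReal_add (le_max_right _ _) (by positivity),
      ← ENNReal.ofReal_add (le_max_right _ _) (by positivity)]
    congr 1
    rcases le_total 0 (f ω) with h1 | h1 <;> rcases le_total 0 (g ω) with h2 | h2 <;>
      rcases le_total 0 (f ω + g ω) with h3 | h3 <;>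
      simp only [max_def] <;> split_ifs <;> linarith
  have m1 := hf.meas
  have m2 := hg.meas
  have a1 := condLExp_add_left (mΩ := m) (P := P) (X := fun ω => ENNReal.ofReal (f ω + g ω))
    ((fun ω => ENNReal.ofReal (-f ω)) + fun ω => ENNReal.ofReal (-g ω)) (by fun_prop)
  have a2 := condLExp_add_left (mΩ := m) (P := P) (X := fun ω => ENNReal.ofReal (-f ω))
    (fun ω => ENNReal.ofReal (-g ω)) (by fun_prop)
  have a3 := condLExp_add_left (mΩ := m) (P := P) (X := fun ω => ENNReal.ofReal (-(f ω + g ω)))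
    ((fun ω => ENNReal.ofReal (f ω)) + fun ω => ENNReal.ofReal (g ω)) (by fun_prop)
  have a4 := condLExp_add_left (mΩ := m) (P := P) (X := fun ω => ENNReal.ofReal (f ω))
    (fun ω => ENNReal.ofReal (g ω)) (by fun_prop)
  rw [key] at a1
  filter_upwards [a1, a2, a3, a4, hf.pos_lt_top, hf.neg_lt_top, hg.pos_lt_top, hg.neg_lt_top,
    hfg.pos_lt_top, hfg.neg_lt_top] with ω a1 a2 a3 a4 b1 b2 b3 b4 b5 b6
  rw [a3] at a1
  simp only [Pi.add_apply, a2, a4] at a1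
  have := congrArg ENNReal.toReal a1
  rw [ENNReal.toReal_add b6.ne (ENNReal.add_lt_top.2 ⟨b1, b3⟩).ne,
    ENNReal.toReal_add b1.ne b3.ne, ENNReal.toReal_add b5.ne (ENNReal.add_lt_top.2 ⟨b2, b4⟩).ne,
    ENNReal.toReal_add b2.ne b4.ne] at this
  simp only [ce]
  linarith

theorem ce_sub {f g : Ω → ℝ} (hf : CondIntegrable P m f) (hg : CondIntegrable P m g) :
    ce P m (fun ω => f ω - g ω) =ᵐ[P] fun ω => ce P m f ω - ce P m g ω := by
  filter_upwards [ce_add hf hg.neg] with ω h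
  simpa [sub_eq_add_neg, ce_neg] using h

theorem ce_mul_left (hm : m ≤ mΩ) {r f : Ω → ℝ} (hr : Measurable[m] r)
    (hf : CondIntegrable P m f) :
    ce P m (fun ω => r ω * f ω) =ᵐ[P] fun ω => r ω * ce P m f ω := by
  have hfm := hf.meas
  have hr' := hr.mono hm le_rfl
  have key : ∀ (a b : ℝ), ENNReal.ofReal (a * b) =
      ENNReal.ofReal a * ENNReal.ofReal b + ENNReal.ofReal (-a) * ENNReal.ofReal (-b) := by
    intro a b
    rcases le_total 0 a with h | h
    · simp [ENNReal.ofReal_of_nonpos (neg_nonpos.2 h), ENNReal.ofReal_mul h]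
    · rw [ENNReal.ofReal_of_nonpos h, zero_mul, zero_add,
        ← ENNReal.ofReal_mul (neg_nonneg.2 h), neg_mul_neg]
  have main : ∀ g : Ω → ℝ, CondIntegrable P m g →
      ∀ᵐ ω ∂P, (condLExp m P (fun ω => ENNReal.ofReal (r ω * g ω)) ω).toReal =
      (ENNReal.ofReal (r ω)).toReal * (condLExp m P (fun ω => ENNReal.ofReal (g ω)) ω).toReal +
      (ENNReal.ofReal (-r ω)).toReal *
        (condLExp m P (fun ω => ENNReal.ofReal (-g ω)) ω).toReal := by
    intro g hg
    have hgm := hg.meas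
    have e : (fun ω => ENNReal.ofReal (r ω * g ω)) =
        (fun ω => ENNReal.ofReal (r ω) * ENNReal.ofReal (g ω)) +
        fun ω => ENNReal.ofReal (-r ω) * ENNReal.ofReal (-g ω) := by
      ext ω; exact key _ _
    have a1 := condLExp_add_left (mΩ := m) (P := P)
      (X := fun ω => ENNReal.ofReal (r ω) * ENNReal.ofReal (g ω))
      (fun ω => ENNReal.ofReal (-r ω) * ENNReal.ofReal (-g ω)) (by fun_prop)
    rw [← e] at a1
    filter_upwards [a1, condLExp_mul_left (P := P) hm (r := fun ω => ENNReal.ofReal (r ω))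
      (X := fun ω => ENNReal.ofReal (g ω)) (by fun_prop) (by fun_prop),
      condLExp_mul_left (P := P) hm (r := fun ω => ENNReal.ofReal (-r ω))
      (X := fun ω => ENNReal.ofReal (-g ω)) (by fun_prop) (by fun_prop),
      hg.pos_lt_top, hg.neg_lt_top] with ω a1 a2 a3 a4 a5
    rw [a1, Pi.add_apply, a2, a3, ENNReal.toReal_add (ENNReal.mul_lt_top ENNReal.ofReal_lt_top a4).ne
      (ENNReal.mul_lt_top ENNReal.ofReal_lt_top a5).ne, ENNReal.toReal_mul, ENNReal.toReal_mul]
  filter_upwards [main f hf, main _ hf.neg] with ω h1 h2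
  simp only [ce, ← mul_neg, h1, h2, neg_neg]
  have : r ω = (ENNReal.ofReal (r ω)).toReal - (ENNReal.ofReal (-r ω)).toReal := by
    rcases le_total 0 (r ω) with h | h
    · simp [h, ENNReal.ofReal_of_nonpos (neg_nonpos.2 h)]
    · simp [h, ENNReal.ofReal_of_nonpos h]
  linear_combination (-(condLExp m P (fun ω => ENNReal.ofReal (f ω)) ω).toReal +
    (condLExp m P (fun ω => ENNReal.ofReal (-f ω)) ω).toReal) * this

theorem ce_congr {f g : Ω → ℝ} (h : f =ᵐ[P] g) : ce P m f =ᵐ[P] ce P m g := by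
  filter_upwards [condLExp_congr_ae (mΩ := m) (P := P) (X := fun ω => ENNReal.ofReal (f ω))
    (Y := fun ω => ENNReal.ofReal (g ω)) (by filter_upwards [h] with ω h; rw [h]),
    condLExp_congr_ae (mΩ := m) (P := P) (X := fun ω => ENNReal.ofReal (-f ω))
    (Y := fun ω => ENNReal.ofReal (-g ω)) (by filter_upwards [h] with ω h; rw [h])] with ω h1 h2
  simp only [ce, h1, h2]

theorem ce_mono {f g : Ω → ℝ} (hf : CondIntegrable P m f) (hg : CondIntegrable P m g)
    (h : ∀ᵐ ω ∂P, f ω ≤ g ω) : ∀ᵐ ω ∂P, ce P m f ω ≤ ce P m g ω := by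
  filter_upwards [condLExp_mono (mΩ := m) (P := P) (X := fun ω => ENNReal.ofReal (f ω))
    (Y := fun ω => ENNReal.ofReal (g ω))
    (by filter_upwards [h] with ω h using ENNReal.ofReal_le_ofReal h),
    condLExp_mono (mΩ := m) (P := P) (X := fun ω => ENNReal.ofReal (-g ω))
    (Y := fun ω => ENNReal.ofReal (-f ω))
    (by filter_upwards [h] with ω h using ENNReal.ofReal_le_ofReal (neg_le_neg h)),
    hg.pos_lt_top, hf.neg_lt_top] with ω h1 h2 h3 h4
  exact sub_le_sub (ENNReal.toReal_mono h3.ne h1) (ENNReal.toReal_mono h4.ne h2)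

theorem ce_mono_on (hm : m ≤ mΩ) {f g : Ω → ℝ} (hf : CondIntegrable P m f)
    (hg : CondIntegrable P m g) {A : Set Ω} (hA : MeasurableSet[m] A)
    (h : ∀ᵐ ω ∂P, ω ∈ A → f ω ≤ g ω) : ∀ᵐ ω ∂P, ω ∈ A → ce P m f ω ≤ ce P m g ω := by
  have hr : Measurable[m] (A.indicator (fun _ => (1 : ℝ))) := measurable_const.indicator hA
  filter_upwards [ce_mul_left hm hr hf, ce_mul_left hm hr hg,
    ce_mono (hf.mul_left hm hr) (hg.mul_left hm hr) (by
      filter_upwards [h] with ω h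
      by_cases hω : ω ∈ A
      · simpa [hω] using h hω
      · simp [hω])] with ω h1 h2 h3 hω
  rw [h1, h2] at h3
  simpa [hω] using h3

theorem ce_congr_on (hm : m ≤ mΩ) {f g : Ω → ℝ} (hf : CondIntegrable P m f)
    (hg : CondIntegrable P m g) {A : Set Ω} (hA : MeasurableSet[m] A)
    (h : ∀ᵐ ω ∂P, ω ∈ A → f ω = g ω) : ∀ᵐ ω ∂P, ω ∈ A → ce P m f ω = ce P m g ω := by
  filter_upwards [ce_mono_on hm hf hg hA (h.mono fun ω h hω => (h hω).le),
    ce_mono_on hm hg hf hA (h.mono fun ω h hω => (h hω).ge)] with ω h1 h2 hω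
  exact le_antisymm (h1 hω) (h2 hω)

theorem condLExp_ofReal_eq {f : Ω → ℝ} (hf : CondIntegrable P m f) (h : ∀ᵐ ω ∂P, 0 ≤ f ω) :
    condLExp m P (fun ω => ENNReal.ofReal (f ω)) =ᵐ[P] fun ω => ENNReal.ofReal (ce P m f ω) := by
  have h0 : condLExp m P (fun ω => ENNReal.ofReal (-f ω)) =ᵐ[P] 0 := by
    have := condLExp_congr_ae (mΩ := m) (P := P) (X := fun ω => ENNReal.ofReal (-f ω))
      (Y := 0) (by filter_upwards [h] with ω h; simp [h])
    simpa using this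
  filter_upwards [h0, hf.pos_lt_top] with ω h1 h2
  simp [ce, h1, h2.ne]

theorem genCondExp_eq_ce {f : Ω → ℝ} (hf : CondIntegrable P m f) :
    ∀ᵐ ω ∂P, genCondExp P m f ω = ((ce P m f ω : ℝ) : EReal) := by
  filter_upwards [hf.pos_lt_top, hf.neg_lt_top] with ω h1 h2
  rw [genCondExp, ce, EReal.coe_sub, EReal.coe_ennreal_toReal h1.ne, EReal.coe_ennreal_toReal h2.ne]

end CondExp
-- The one-period problem and domination of bounded positions
section OneStep

open Filter Topology
open scoped ENNReal

variable {Ω : Type*} {m mΩ : MeasurableSpace Ω} {P : Measure Ω} {d : ℕ}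

/-- A random function with nondecreasing concave paths, bounded from below by the deterministic
function `L`, unbounded from below at `-∞`, and with growth controlled by the two powers `p`, `q`:
`V(λx) ≤ λ^p (V(x) + C)` and `V(λx) ≤ λ^q (V(x) + C)` for all `x` and `λ ≥ 1`. -/
structure RandomUtility {mΩ : MeasurableSpace Ω} (P : Measure[mΩ] Ω) (m : MeasurableSpace Ω)
    (L : ℝ → ℝ) (p q C : ℝ) (V : ℝ → Ω → ℝ) : Prop where
  meas : ∀ x, Measurable[m] (V x)
  mono : ∀ ω, Monotone fun x => V x ω
  concave : ∀ ω, ConcaveOn ℝ Set.univ fun x => V x ω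
  lower : ∀ᵐ ω ∂P, ∀ x, L x ≤ V x ω
  growth : ∀ᵐ ω ∂P, ∀ x l : ℝ, 1 ≤ l →
    V (l * x) ω ≤ l ^ p * (V x ω + C) ∧ V (l * x) ω ≤ l ^ q * (V x ω + C)
  unbounded : ∀ᵐ ω ∂P, Tendsto (fun n : ℕ => V (-n) ω) atTop atBot

theorem continuous_of_concaveOn_univ {f : ℝ → ℝ} (hf : ConcaveOn ℝ Set.univ f) :
    Continuous f :=
  continuousOn_univ.1 (hf.continuousOn isOpen_univ)

theorem measurable_eval {m : MeasurableSpace Ω} {V : ℝ → Ω → ℝ} (hV : ∀ x, Measurable[m] (V x))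
    (hc : ∀ ω, Continuous fun x => V x ω) {Z : Ω → ℝ} (hZ : Measurable[m] Z) :
    Measurable[m] fun ω => V (Z ω) ω :=
  (measurable_uncurry_of_continuous_of_measurable (u := V) hc hV).comp (hZ.prodMk measurable_id)

/-- The random payoff `V(X + ⟨ξ, Y⟩)`. -/
noncomputable def payoff (V : ℝ → Ω → ℝ) (Y : Ω → EuclideanSpace ℝ (Fin d)) (X : Ω → ℝ)
    (ξ : Ω → EuclideanSpace ℝ (Fin d)) (ω : Ω) : ℝ :=
  V (X ω + inner ℝ (ξ ω) (Y ω)) ω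

/-- The data of a one-period problem without arbitrage. -/
structure OnePeriod {mΩ : MeasurableSpace Ω} (P : Measure[mΩ] Ω) (m : MeasurableSpace Ω)
    (Y : Ω → EuclideanSpace ℝ (Fin d)) (L : ℝ → ℝ) (p q C : ℝ) (V : ℝ → Ω → ℝ) : Prop where
  le : m ≤ mΩ
  complete : ∀ N : Set Ω, P N = 0 → MeasurableSet[m] N
  measY : Measurable[mΩ] Y
  noArbitrage : ∀ ξ : Ω → EuclideanSpace ℝ (Fin d), Measurable[m] ξ →
    (∀ᵐ ω ∂P, 0 ≤ inner ℝ (ξ ω) (Y ω)) → ∀ᵐ ω ∂P, inner ℝ (ξ ω) (Y ω) = 0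
  continuous_L : Continuous L
  p_pos : 0 < p
  p_lt_q : p < q
  C_nonneg : 0 ≤ C
  utility : RandomUtility P mΩ L p q C V
  finite : ∀ y : EuclideanSpace ℝ (Fin d),
    ∀ᵐ ω ∂P, condLExp m P (fun ω => ENNReal.ofReal (V (1 + inner ℝ y (Y ω)) ω)) ω < ⊤

/-- The vector with coordinates `±1` according to `s`. -/
noncomputable def signVec (s : Fin d → Bool) : EuclideanSpace ℝ (Fin d) :=
  WithLp.toLp 2 fun i => if s i then 1 else -1

theorem exists_inner_signVec (y : EuclideanSpace ℝ (Fin d)) :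
    ∃ s, ‖y‖ ≤ inner ℝ (signVec s) y := by
  refine ⟨fun i => decide (0 ≤ y i), ?_⟩
  have h1 : inner ℝ (signVec fun i => decide (0 ≤ y i)) y = ∑ i, |y i| := by
    simp only [PiLp.inner_apply, signVec]
    refine Finset.sum_congr rfl fun i _ => ?_
    by_cases h : 0 ≤ y i
    · simp [h, abs_of_nonneg h]
    · simp [h, abs_of_neg (not_le.1 h)]
  rw [h1, EuclideanSpace.norm_eq]
  refine Real.sqrt_le_iff.2 ⟨Finset.sum_nonneg fun i _ => abs_nonneg _, ?_⟩
  simp only [Real.norm_eq_abs]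
  exact Finset.sum_sq_le_sq_sum_of_nonneg fun i _ => abs_nonneg _

/-- A random variable dominating the payoffs of all bounded positions. -/
noncomputable def dominant (V : ℝ → Ω → ℝ) (Y : Ω → EuclideanSpace ℝ (Fin d)) (C : ℝ) (ω : Ω) :
    ℝ :=
  ∑ s : Fin d → Bool, max (V (1 + inner ℝ (signVec s) (Y ω)) ω) 0 + C

variable [IsProbabilityMeasure P]
  {Y : Ω → EuclideanSpace ℝ (Fin d)} {L : ℝ → ℝ} {p q C : ℝ} {V : ℝ → Ω → ℝ}

theorem CondIntegrable.abs {f : Ω → ℝ} (hf : CondIntegrable P m f) :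
    CondIntegrable P m fun ω => |f ω| :=
  hf.mono hf.meas.abs (by simp)

theorem CondIntegrable.sum (hm : m ≤ mΩ) {ι : Type*} (s : Finset ι) {f : ι → Ω → ℝ}
    (hf : ∀ i ∈ s, CondIntegrable P m (f i)) : CondIntegrable P m fun ω => ∑ i ∈ s, f i ω := by
  classical
  induction s using Finset.induction_on with
  | empty => simpa using condIntegrable_of_measurable (P := P) hm measurable_const
  | insert i s hi ih =>
    simp only [Finset.sum_insert hi]
    exact (hf i (by simp)).add (ih fun j hj => hf j (by simp [hj]))

/-- Lower and upper conditionally integrable bounds give conditional integrability. -/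
theorem CondIntegrable.of_le_of_le {f a b : Ω → ℝ} (hf : Measurable f) (ha : CondIntegrable P m a)
    (hb : CondIntegrable P m b) (h1 : ∀ᵐ ω ∂P, a ω ≤ f ω) (h2 : ∀ᵐ ω ∂P, f ω ≤ b ω) :
    CondIntegrable P m f := by
  refine (ha.abs.add hb.abs).mono hf ?_
  filter_upwards [h1, h2] with ω h1 h2
  rw [abs_of_nonneg (a := |a ω| + |b ω|) (by positivity), abs_le]
  constructor
  · linarith [neg_abs_le (a ω), abs_nonneg (b ω)]
  · linarith [le_abs_self (b ω), abs_nonneg (a ω)]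

namespace RandomUtility

theorem continuous (h : RandomUtility P m L p q C V) (ω : Ω) : Continuous fun x => V x ω :=
  continuous_of_concaveOn_univ (h.concave ω)

theorem measurable_eval (h : RandomUtility P m L p q C V) {Z : Ω → ℝ} (hZ : Measurable[m] Z) :
    Measurable[m] fun ω => V (Z ω) ω :=
  UtilityMax.measurable_eval h.meas h.continuous hZ

end RandomUtility

namespace OnePeriod

theorem measurable_payoff (h : OnePeriod P m Y L p q C V) {X : Ω → ℝ}
    {ξ : Ω → EuclideanSpace ℝ (Fin d)} (hX : Measurable X) (hξ : Measurable ξ) :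
    Measurable (payoff V Y X ξ) :=
  h.utility.measurable_eval (hX.add (hξ.inner h.measY))

theorem condIntegrable_dominant (h : OnePeriod P m Y L p q C V) :
    CondIntegrable P m (dominant V Y C) := by
  refine (CondIntegrable.sum h.le _ fun s _ => ?_).add
    (condIntegrable_of_measurable h.le measurable_const)
  have hm : Measurable fun ω => V (1 + inner ℝ (signVec s) (Y ω)) ω :=
    h.utility.measurable_eval (measurable_const.add (measurable_const.inner h.measY))
  refine ⟨hm.max measurable_const, ?_⟩
  filter_upwards [h.finite (signVec s), condLExp_congr_ae (P := P) (mΩ := m)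
    (X := fun ω => ENNReal.ofReal |max (V (1 + inner ℝ (signVec s) (Y ω)) ω) 0|)
    (Y := fun ω => ENNReal.ofReal (V (1 + inner ℝ (signVec s) (Y ω)) ω))
    (ae_of_all _ fun ω => by simp [abs_of_nonneg])] with ω h1 h2
  rwa [h2]

/-- For wealth and position of size at most `r`, the final wealth is at most `r (1 + ‖Y‖)`, and
`‖Y‖` is dominated by the gain of one of finitely many sign vectors; the factor `r` comes out
through the growth bound with exponent `p`. -/
theorem payoff_le_dominant (h : OnePeriod P m Y L p q C V) :
    ∀ᵐ ω ∂P, ∀ (r x : ℝ) (y : EuclideanSpace ℝ (Fin d)), 1 ≤ r → x ≤ r → ‖y‖ ≤ r →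
      V (x + inner ℝ y (Y ω)) ω ≤ r ^ p * dominant V Y C ω := by
  filter_upwards [h.utility.growth] with ω hω r x y hr hx hy
  obtain ⟨s, hs⟩ := exists_inner_signVec (Y ω)
  have h1 : x + inner ℝ y (Y ω) ≤ r * (1 + inner ℝ (signVec s) (Y ω)) := by
    have h2 : inner ℝ y (Y ω) ≤ r * ‖Y ω‖ :=
      (real_inner_le_norm _ _).trans (mul_le_mul_of_nonneg_right hy (norm_nonneg _))
    have h3 : r * ‖Y ω‖ ≤ r * inner ℝ (signVec s) (Y ω) :=
      mul_le_mul_of_nonneg_left hs (by linarith)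
    linarith
  refine (h.utility.mono ω h1).trans ((hω _ r hr).1.trans ?_)
  refine mul_le_mul_of_nonneg_left ?_ (by positivity)
  refine add_le_add_left ?_ C
  refine (le_max_left _ 0).trans ?_
  exact Finset.single_le_sum (f := fun s => max (V (1 + inner ℝ (signVec s) (Y ω)) ω) 0)
    (fun _ _ => le_max_right _ _) (Finset.mem_univ s)

/-- Conditional integrability of a payoff follows from a lower bound. -/
theorem condIntegrable_payoff (h : OnePeriod P m Y L p q C V) {X : Ω → ℝ}
    {ξ : Ω → EuclideanSpace ℝ (Fin d)} (hX : Measurable[m] X) (hξ : Measurable[m] ξ)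
    {b : Ω → ℝ} (hb : CondIntegrable P m b) (hle : ∀ᵐ ω ∂P, b ω ≤ payoff V Y X ξ ω) :
    CondIntegrable P m (payoff V Y X ξ) := by
  refine CondIntegrable.of_le_of_le (h.measurable_payoff (hX.mono h.le le_rfl)
    (hξ.mono h.le le_rfl)) hb
    (h.condIntegrable_dominant.mul_left h.le (r := fun ω => (1 + |X ω| + ‖ξ ω‖) ^ p) ?_) hle ?_
  · fun_prop
  · filter_upwards [h.payoff_le_dominant] with ω hω
    refine hω _ _ _ ?_ ?_ ?_
    · linarith [abs_nonneg (X ω), norm_nonneg (ξ ω)]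
    · linarith [le_abs_self (X ω), norm_nonneg (ξ ω)]
    · linarith [abs_nonneg (X ω)]

theorem condIntegrable_eval (h : OnePeriod P m Y L p q C V) {X : Ω → ℝ}
    (hX : Measurable[m] X) : CondIntegrable P m (payoff V Y X 0) := by
  refine h.condIntegrable_payoff hX measurable_const
    (condIntegrable_of_measurable h.le (h.continuous_L.measurable.comp hX)) ?_
  filter_upwards [h.utility.lower] with ω hω
  simpa [payoff] using hω (X ω)

end OnePeriod

end OneStep
-- Measurable subsequences and orthogonal positions
section Selection

open Filter Topology
open scoped ENNReal

variable {Ω : Type*}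

theorem measurable_eval_nat {m : MeasurableSpace Ω} {β : Type*} [MeasurableSpace β]
    {u : ℕ → Ω → β} (hu : ∀ n, Measurable (u n)) {τ : Ω → ℕ} (hτ : Measurable τ) :
    Measurable fun ω => u (τ ω) ω := by
  have : Measurable fun z : ℕ × Ω => u z.1 z.2 := measurable_from_prod_countable_right hu
  exact this.comp (hτ.prodMk measurable_id)

/-- The lower limit is a measurable cluster value; the first index beyond `k` at which the sequence
is `1/(k+1)`-close to it is a measurable random index. The indices need not increase: `k ≤ τ k`
suffices. -/
theorem exists_measurable_subseq_real {m : MeasurableSpace Ω} {u : ℕ → Ω → ℝ}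
    (hu : ∀ n, Measurable (u n)) (hb : ∀ ω, ∃ K, ∀ n, |u n ω| ≤ K) :
    ∃ τ : ℕ → Ω → ℕ, (∀ k, Measurable (τ k)) ∧ (∀ k ω, k ≤ τ k ω) ∧
      ∀ ω, ∃ l, Tendsto (fun k => u (τ k ω) ω) atTop (𝓝 l) := by
  classical
  let l : Ω → ℝ := fun ω => liminf (fun n => u n ω) atTop
  have hl : Measurable l := Measurable.liminf hu
  have hex : ∀ (k : ℕ) (ω : Ω), ∃ n, k ≤ n ∧ |u n ω - l ω| < 1 / ((k : ℝ) + 1) := by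
    intro k ω
    obtain ⟨K, hK⟩ := hb ω
    have hε : (0 : ℝ) < 1 / ((k : ℝ) + 1) := by positivity
    have bd1 : IsBoundedUnder (· ≥ ·) atTop fun n => u n ω :=
      isBoundedUnder_of ⟨-K, fun n => (abs_le.1 (hK n)).1⟩
    have bd2 : IsCoboundedUnder (· ≥ ·) atTop fun n => u n ω :=
      IsBoundedUnder.isCoboundedUnder_ge (isBoundedUnder_of ⟨K, fun n => (abs_le.1 (hK n)).2⟩)
    have h1 : ∀ᶠ n in atTop, l ω - 1 / ((k : ℝ) + 1) < u n ω :=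
      eventually_lt_of_lt_liminf (by change _ < l ω; linarith) bd1
    have h2 : ∃ᶠ n in atTop, u n ω < l ω + 1 / ((k : ℝ) + 1) :=
      frequently_lt_of_liminf_lt bd2 (by change l ω < _; linarith)
    obtain ⟨n, h3, h4, h5⟩ := (h2.and_eventually (h1.and (eventually_ge_atTop k))).exists
    exact ⟨n, h5, abs_lt.2 ⟨by linarith, by linarith⟩⟩
  refine ⟨fun k ω => Nat.find (hex k ω), fun k => ?_, fun k ω => (Nat.find_spec (hex k ω)).1,
    fun ω => ⟨l ω, ?_⟩⟩
  · refine measurable_find _ fun n => ?_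
    refine MeasurableSet.inter (MeasurableSet.const _) ?_
    exact measurableSet_lt (((hu n).sub hl).abs) measurable_const
  · rw [tendsto_iff_dist_tendsto_zero]
    refine squeeze_zero (fun _ => dist_nonneg) (fun k => ?_) tendsto_one_div_add_atTop_nhds_zero_nat
    rw [Real.dist_eq]
    exact (Nat.find_spec (hex k ω)).2.le

theorem exists_measurable_subseq_pi {m : MeasurableSpace Ω} {ι : Type*}
    {u : ℕ → Ω → ι → ℝ} (hu : ∀ n i, Measurable fun ω => u n ω i)
    (hb : ∀ ω i, ∃ K, ∀ n, |u n ω i| ≤ K) (s : Finset ι) :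
    ∃ τ : ℕ → Ω → ℕ, (∀ k, Measurable (τ k)) ∧ (∀ k ω, k ≤ τ k ω) ∧
      ∀ i ∈ s, ∀ ω, ∃ l, Tendsto (fun k => u (τ k ω) ω i) atTop (𝓝 l) := by
  classical
  induction s using Finset.induction_on with
  | empty => exact ⟨fun k _ => k, fun k => measurable_const, fun k ω => le_rfl, by simp⟩
  | insert i s hi ih =>
    obtain ⟨τ, h1, h2, h3⟩ := ih
    obtain ⟨σ, g1, g2, g3⟩ := exists_measurable_subseq_real (u := fun k ω => u (τ k ω) ω i)
      (fun k => measurable_eval_nat (fun n => hu n i) (h1 k)) (fun ω => by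
        obtain ⟨K, hK⟩ := hb ω i
        exact ⟨K, fun n => hK _⟩)
    refine ⟨fun k ω => τ (σ k ω) ω, fun k => measurable_eval_nat h1 (g1 k),
      fun k ω => (g2 k ω).trans (h2 _ ω), fun j hj ω => ?_⟩
    rcases Finset.mem_insert.1 hj with rfl | hj
    · exact g3 ω
    · obtain ⟨l, hl⟩ := h3 j hj ω
      exact ⟨l, hl.comp (tendsto_atTop_mono (fun k => g2 k ω) tendsto_id)⟩

/-- A measurable version of the Bolzano-Weierstrass theorem. -/
theorem exists_measurable_subseq {m : MeasurableSpace Ω} {d : ℕ} {X : ℕ → Ω → ℝ}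
    {ξ : ℕ → Ω → EuclideanSpace ℝ (Fin d)} (hX : ∀ n, Measurable (X n))
    (hξ : ∀ n, Measurable (ξ n)) (hb : ∀ ω, ∃ K, ∀ n, |X n ω| ≤ K ∧ ‖ξ n ω‖ ≤ K) :
    ∃ (τ : ℕ → Ω → ℕ) (x : Ω → ℝ) (η : Ω → EuclideanSpace ℝ (Fin d)),
      (∀ k, Measurable (τ k)) ∧ (∀ k ω, k ≤ τ k ω) ∧ Measurable x ∧ Measurable η ∧
      (∀ ω, Tendsto (fun k => X (τ k ω) ω) atTop (𝓝 (x ω))) ∧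
      ∀ ω, Tendsto (fun k => ξ (τ k ω) ω) atTop (𝓝 (η ω)) := by
  obtain ⟨τ, h1, h2, h3⟩ := exists_measurable_subseq_pi (ι := Option (Fin d))
    (u := fun n ω i => i.elim (X n ω) fun j => ξ n ω j)
    (fun n i => by
      cases i with
      | none => exact hX n
      | some j => exact (EuclideanSpace.proj (𝕜 := ℝ) j).continuous.measurable.comp (hξ n))
    (fun ω i => by
      obtain ⟨K, hK⟩ := hb ω
      refine ⟨K, fun n => ?_⟩
      cases i with
      | none => exact (hK n).1
      | some j => exact (PiLp.norm_apply_le (ξ n ω) j).trans (hK n).2) Finset.univ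
  choose l hl using fun i => h3 i (Finset.mem_univ i)
  have hη : ∀ ω, Tendsto (fun k => ξ (τ k ω) ω) atTop
      (𝓝 (WithLp.toLp 2 fun j => l (some j) ω)) := by
    intro ω
    have : Tendsto (fun k => WithLp.ofLp (ξ (τ k ω) ω)) atTop (𝓝 fun j => l (some j) ω) :=
      tendsto_pi_nhds.2 fun j => hl (some j) ω
    exact ((PiLp.continuous_toLp 2 _).tendsto _).comp this
  refine ⟨τ, l none, fun ω => WithLp.toLp 2 fun j => l (some j) ω, h1, h2, ?_, ?_,
    hl none, hη⟩
  · exact measurable_of_tendsto_metrizable (fun k => measurable_eval_nat hX (h1 k))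
      (tendsto_pi_nhds.2 (hl none))
  · exact measurable_of_tendsto_metrizable (fun k => measurable_eval_nat hξ (h1 k))
      (tendsto_pi_nhds.2 hη)

variable {m mΩ : MeasurableSpace Ω} {P : Measure Ω} [IsProbabilityMeasure P] {d : ℕ}

/-- Every position has the same gain as one that is orthogonal to all positions without gain. -/
theorem exists_orthogonal_position (hm : m ≤ mΩ) {Y : Ω → EuclideanSpace ℝ (Fin d)}
    {ξ : Ω → EuclideanSpace ℝ (Fin d)} (hξ : Measurable[m] ξ) :
    ∃ ξ' : Ω → EuclideanSpace ℝ (Fin d), Measurable[m] ξ' ∧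
      (∀ᵐ ω ∂P, inner ℝ (ξ' ω) (Y ω) = inner ℝ (ξ ω) (Y ω)) ∧
      ∀ ν : Ω → EuclideanSpace ℝ (Fin d), Measurable[m] ν →
        (∀ᵐ ω ∂P, inner ℝ (ν ω) (Y ω) = 0) → ∀ᵐ ω ∂P, inner ℝ (ξ' ω) (ν ω) = 0 := by
  -- In `L²` of the trimmed measure every class has an `m`-measurable representative, so an
  -- orthogonal projection there replaces a measurable choice of subspaces.
  let Q := P.trim hm
  have hQ : IsFiniteMeasure Q := isFiniteMeasure_trim hm
  let K : Submodule ℝ (Lp (EuclideanSpace ℝ (Fin d)) 2 Q) :=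
    { carrier := {f | ∀ᵐ ω ∂P, inner ℝ (f ω) (Y ω) = 0}
      add_mem' := by
        intro f g hf hg
        filter_upwards [hf, hg, ae_of_ae_trim hm (Lp.coeFn_add f g)] with ω h1 h2 h3
        rw [h3, Pi.add_apply, inner_add_left, h1, h2, add_zero]
      zero_mem' := by
        filter_upwards [ae_of_ae_trim hm (Lp.coeFn_zero (EuclideanSpace ℝ (Fin d)) 2 Q)] with ω h3
        rw [h3, Pi.zero_apply, inner_zero_left]
      smul_mem' := by
        intro c f hf
        filter_upwards [hf, ae_of_ae_trim hm (Lp.coeFn_smul c f)] with ω h1 h3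
        rw [h3, Pi.smul_apply, inner_smul_left, h1, mul_zero] }
  have hK : IsClosed (K : Set (Lp (EuclideanSpace ℝ (Fin d)) 2 Q)) := by
    refine IsSeqClosed.isClosed fun f g hf hfg => ?_
    obtain ⟨ns, -, hns⟩ := (tendstoInMeasure_of_tendsto_Lp hfg).exists_seq_tendsto_ae
    change ∀ᵐ ω ∂P, _
    filter_upwards [ae_of_ae_trim hm hns, ae_all_iff.2 fun n => (show ∀ᵐ ω ∂P, _ from hf (ns n))]
      with ω h1 h2
    refine tendsto_nhds_unique (h1.inner tendsto_const_nhds) ?_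
    simp [h2]
  have : CompleteSpace K := hK.completeSpace_coe
  -- An arbitrary position need not be square integrable; it is scaled to be bounded, projected, and
  -- scaled back by the same `m`-measurable factor.
  have hb : ∀ ω, ‖(1 + ‖ξ ω‖)⁻¹ • ξ ω‖ ≤ 1 := by
    intro ω
    rw [norm_smul, norm_inv, Real.norm_of_nonneg (by positivity), inv_mul_le_one₀ (by positivity)]
    linarith
  have hζ : MemLp (fun ω => (1 + ‖ξ ω‖)⁻¹ • ξ ω) 2 Q :=
    MemLp.of_bound (C := 1) (Measurable.aestronglyMeasurable (by fun_prop)) (ae_of_all _ hb)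
  let f := hζ.toLp
  let g := f - K.starProjection f
  have hgK : g ∈ Kᗮ := K.sub_starProjection_mem_orthogonal f
  have hpK : K.starProjection f ∈ K := K.starProjection_apply_mem f
  have hgm : Measurable[m] g := (Lp.stronglyMeasurable g).measurable
  refine ⟨fun ω => (1 + ‖ξ ω‖) • g ω, by fun_prop, ?_, fun ν hν hνY => ?_⟩
  · filter_upwards [hpK, ae_of_ae_trim hm (Lp.coeFn_sub f (K.starProjection f)),
      ae_of_ae_trim hm hζ.coeFn_toLp] with ω h1 h2 h3
    have h4 : g ω = f ω - K.starProjection f ω := h2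
    rw [inner_smul_left, h4, inner_sub_left, h1, h3, inner_smul_left]
    have : (1 + ‖ξ ω‖) ≠ 0 := by positivity
    simp [mul_inv_cancel_left₀ this]
  · let s : Ω → ℝ := fun ω => inner ℝ (g ω) (ν ω)
    have hs : Measurable[m] s := hgm.inner hν
    -- Zero-gain positions are stable under `m`-measurable scalars. Testing against `c • ν`, where
    -- `c` has the sign of `s` and makes the product bounded, gives the integral of a nonnegative
    -- function; its vanishing turns `L²` orthogonality into pointwise orthogonality.
    let c : Ω → ℝ := fun ω => s ω * ((1 + |s ω|) * (1 + ‖ν ω‖))⁻¹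
    have hc : Measurable[m] c := by fun_prop
    have hcb : ∀ ω, ‖c ω • ν ω‖ ≤ 1 := by
      intro ω
      rw [norm_smul, norm_mul, norm_inv, Real.norm_of_nonneg (r := (1 + |s ω|) * (1 + ‖ν ω‖))
        (by positivity), Real.norm_eq_abs, mul_right_comm, ← div_eq_mul_inv,
        div_le_one (by positivity)]
      gcongr <;> linarith
    have hκ : MemLp (fun ω => c ω • ν ω) 2 Q :=
      MemLp.of_bound (C := 1) (Measurable.aestronglyMeasurable (by fun_prop)) (ae_of_all _ hcb)
    let k := hκ.toLp
    have hk : k =ᵐ[Q] fun ω => c ω • ν ω := hκ.coeFn_toLp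
    have hκK : k ∈ K := by
      change ∀ᵐ ω ∂P, _
      filter_upwards [hνY, ae_of_ae_trim hm hk] with ω h1 h2
      rw [h2, inner_smul_left, h1, mul_zero]
    have h0 : inner ℝ g k = 0 := (Submodule.mem_orthogonal' _ _).1 hgK _ hκK
    rw [L2.inner_def] at h0
    have hnn : 0 ≤ᵐ[Q] fun ω => (inner ℝ (g ω) (k ω) : ℝ) := by
      filter_upwards [hk] with ω h2
      rw [h2, inner_smul_right]
      have : c ω * inner ℝ (g ω) (ν ω) = s ω * s ω * ((1 + |s ω|) * (1 + ‖ν ω‖))⁻¹ := by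
        simp only [c]; ring
      rw [this]
      exact mul_nonneg (mul_self_nonneg _) (by positivity)
    have h1 := (integral_eq_zero_iff_of_nonneg_ae hnn (L2.integrable_inner g k)).1 h0
    filter_upwards [ae_of_ae_trim hm h1, ae_of_ae_trim hm hk] with ω h1 h2
    rw [h2, inner_smul_right] at h1
    have h3 : s ω * s ω * ((1 + |s ω|) * (1 + ‖ν ω‖))⁻¹ = 0 := by
      rw [← show (0 : Ω → ℝ) ω = 0 from rfl, ← h1]
      simp only [c, s]; ring
    have h4 : ((1 + |s ω|) * (1 + ‖ν ω‖))⁻¹ ≠ 0 := by positivity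
    have h5 : s ω = 0 := mul_self_eq_zero.1 ((mul_eq_zero.1 h3).resolve_right h4)
    rw [inner_smul_left]
    simp only [s] at h5
    simp [h5]

end Selection
-- Localization, upper semicontinuity and limit directions
section Compactness

open Filter Topology
open scoped ENNReal

variable {Ω : Type*} {m mΩ : MeasurableSpace Ω} {P : Measure Ω} [IsProbabilityMeasure P] {d : ℕ}

theorem condLExp_congr_on (hm : m ≤ mΩ) {X Z : Ω → ℝ≥0∞} (hX : Measurable X) (hZ : Measurable Z)
    {A : Set Ω} (hA : MeasurableSet[m] A) (h : ∀ᵐ ω ∂P, ω ∈ A → X ω = Z ω) :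
    ∀ᵐ ω ∂P, ω ∈ A → condLExp m P X ω = condLExp m P Z ω := by
  have hr : Measurable[m] (A.indicator (fun _ => (1 : ℝ≥0∞))) := measurable_const.indicator hA
  filter_upwards [condLExp_mul_left (P := P) hm hr hX, condLExp_mul_left (P := P) hm hr hZ,
    condLExp_congr_ae (mΩ := m) (P := P) (X := fun ω => A.indicator (fun _ => (1 : ℝ≥0∞)) ω * X ω)
      (Y := fun ω => A.indicator (fun _ => (1 : ℝ≥0∞)) ω * Z ω) (by
      filter_upwards [h] with ω h
      by_cases hω : ω ∈ A
      · simpa [hω] using h hω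
      · simp [hω])] with ω h1 h2 h3 hω
  rw [h1, h2] at h3
  simpa [hω] using h3

theorem CondIntegrable.of_cover (hm : m ≤ mΩ) {f : Ω → ℝ} (hf : Measurable f) {g : ℕ → Ω → ℝ}
    (hg : ∀ n, CondIntegrable P m (g n)) {A : ℕ → Set Ω} (hA : ∀ n, MeasurableSet[m] (A n))
    (hcov : ∀ ω, ∃ n, ω ∈ A n) (heq : ∀ n, ∀ᵐ ω ∂P, ω ∈ A n → f ω = g n ω) :
    CondIntegrable P m f := by
  refine ⟨hf, ?_⟩
  have h := fun n => condLExp_congr_on (P := P) hm (X := fun ω => ENNReal.ofReal |f ω|)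
    (Z := fun ω => ENNReal.ofReal |g n ω|) hf.abs.ennreal_ofReal (hg n).meas.abs.ennreal_ofReal
    (hA n) ((heq n).mono fun ω h hω => by rw [h hω])
  filter_upwards [ae_all_iff.2 h, ae_all_iff.2 fun n => (hg n).fin] with ω h1 h2
  obtain ⟨n, hn⟩ := hcov ω
  rw [h1 n hn]
  exact h2 n

theorem CondIntegrable.random_index (hm : m ≤ mΩ) {f : ℕ → Ω → ℝ}
    (hf : ∀ n, CondIntegrable P m (f n)) {τ : Ω → ℕ} (hτ : Measurable[m] τ) :
    CondIntegrable P m fun ω => f (τ ω) ω :=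
  .of_cover hm (measurable_eval_nat (fun n => (hf n).meas) (hτ.mono hm le_rfl)) hf
    (A := fun n => τ ⁻¹' {n}) (fun n => hτ (measurableSet_singleton n)) (fun ω => ⟨τ ω, rfl⟩)
    fun n => ae_of_all _ fun ω (hω : τ ω = n) => by rw [hω]

theorem ce_random_index (hm : m ≤ mΩ) {f : ℕ → Ω → ℝ}
    (hf : ∀ n, CondIntegrable P m (f n)) {τ : Ω → ℕ} (hτ : Measurable[m] τ) :
    ∀ᵐ ω ∂P, ce P m (fun ω => f (τ ω) ω) ω = ce P m (f (τ ω)) ω := by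
  have h := fun n => ce_congr_on hm (CondIntegrable.random_index hm hf hτ) (hf n)
    (A := τ ⁻¹' {n}) (hτ (measurableSet_singleton n))
    (ae_of_all _ fun ω (hω : τ ω = n) => by rw [hω])
  filter_upwards [ae_all_iff.2 h] with ω h1
  exact h1 (τ ω) rfl

/-- Upper semicontinuity of conditional expectations along dominated sequences. -/
theorem CondIntegrable.of_tendsto (hm : m ≤ mΩ) {f : ℕ → Ω → ℝ} {g G c : Ω → ℝ}
    (hf : ∀ n, CondIntegrable P m (f n)) (hG : CondIntegrable P m G) (hg : Measurable g)
    (hc : Measurable[m] c) (hle : ∀ n, ∀ᵐ ω ∂P, f n ω ≤ G ω)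
    (hlim : ∀ᵐ ω ∂P, Tendsto (fun n => f n ω) atTop (𝓝 (g ω)))
    (hcf : ∀ᶠ n in atTop, ∀ᵐ ω ∂P, c ω ≤ ce P m (f n) ω) :
    CondIntegrable P m g ∧ ∀ᵐ ω ∂P, c ω ≤ ce P m g ω := by
  have hgG : ∀ᵐ ω ∂P, g ω ≤ G ω := by
    filter_upwards [hlim, ae_all_iff.2 hle] with ω h1 h2
    exact le_of_tendsto h1 (Eventually.of_forall h2)
  have hGm := hG.meas
  have hD : Measurable[m] fun ω => ENNReal.ofReal (ce P m G ω - c ω) :=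
    ((measurable_ce P m G).sub hc).ennreal_ofReal
  -- Fatou's lemma is applied to the nonnegative variables `G - f n`, whose conditional expectations
  -- are eventually at most `E(G | m) - c`.
  have h1 : condLExp m P (fun ω => ENNReal.ofReal (G ω - g ω)) ≤ᵐ[P]
      fun ω => ENNReal.ofReal (ce P m G ω - c ω) := by
    have hfat := condLExp_liminf_le (P := P) hm (h := fun n ω => ENNReal.ofReal (G ω - f n ω))
      (fun n => (hGm.sub (hf n).meas).ennreal_ofReal) hD (by
        filter_upwards [hcf] with n hn
        filter_upwards [condLExp_ofReal_eq (hG.sub (hf n)) (by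
          filter_upwards [hle n] with ω h using sub_nonneg.2 h), ce_sub hG (hf n), hn]
          with ω a1 a2 a3
        rw [a1, a2]
        exact ENNReal.ofReal_le_ofReal (by linarith))
    have hcongr := condLExp_congr_ae (P := P) (mΩ := m)
      (X := fun ω => liminf (fun n => ENNReal.ofReal (G ω - f n ω)) atTop)
      (Y := fun ω => ENNReal.ofReal (G ω - g ω)) (by
        filter_upwards [hlim] with ω h
        exact (ENNReal.tendsto_ofReal (tendsto_const_nhds.sub h)).liminf_eq)
    filter_upwards [hfat, hcongr] with ω a1 a2
    rwa [← a2]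
  have hint : CondIntegrable P m fun ω => G ω - g ω := by
    refine condIntegrable_of_pos_neg (hGm.sub hg) ?_ ?_
    · filter_upwards [h1] with ω h using h.trans_lt ENNReal.ofReal_lt_top
    · filter_upwards [condLExp_congr_ae (P := P) (mΩ := m)
        (X := fun ω => ENNReal.ofReal (-(G ω - g ω))) (Y := 0) (by
          filter_upwards [hgG] with ω h
          simp [h])] with ω h
      rw [h, condLExp_zero]
      simp
  have hgi : CondIntegrable P m g := by simpa using hG.sub hint
  refine ⟨hgi, ?_⟩
  filter_upwards [h1, condLExp_ofReal_eq hint (by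
    filter_upwards [hgG] with ω h using sub_nonneg.2 h), ce_sub hG hgi,
    hcf.exists.choose_spec, ce_mono (hf hcf.exists.choose) hG (hle _)] with ω a1 a2 a3 a4 a5
  rw [a2, ENNReal.ofReal_le_ofReal_iff (by linarith), a3] at a1
  linarith

namespace OnePeriod

variable {Y : Ω → EuclideanSpace ℝ (Fin d)} {L : ℝ → ℝ} {p q C : ℝ} {V : ℝ → Ω → ℝ}

/-- At `-∞` the exponent `q` applies: `V(rz)` falls at least like `-r^q`, faster than the
normalization `r^p`. The exceptional null set does not depend on the sequences. -/
theorem tendsto_div_rpow_atBot (h : OnePeriod P m Y L p q C V) :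
    ∀ᵐ ω ∂P, ∀ (r z : ℕ → ℝ) (z₀ : ℝ), z₀ < 0 → Tendsto r atTop atTop →
      Tendsto z atTop (𝓝 z₀) → Tendsto (fun k => V (r k * z k) ω / r k ^ p) atTop atBot := by
  filter_upwards [h.utility.growth, h.utility.unbounded] with ω hg hu r z z₀ hz₀ hr hz
  -- At this `n` one has `V(-n) + C ≤ -1`, so scaling up from `-n` produces a strictly negative
  -- multiple of a power.
  obtain ⟨n, hn0, hn⟩ := ((eventually_gt_atTop 0).and
    (hu.eventually (eventually_le_atBot (-1 - C)))).exists
  have hn0' : (0 : ℝ) < n := by exact_mod_cast hn0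
  -- Chosen so that `r (z₀ / 2) = (c r) (-n)`: the scaling factor from `-n` is then `c r`.
  let c : ℝ := -z₀ / (2 * n)
  have hc : 0 < c := div_pos (by linarith) (by linarith)
  have hp := h.p_pos
  have hpq := h.p_lt_q
  have hbound : ∀ᶠ k in atTop, V (r k * z k) ω / r k ^ p ≤ -(c ^ q * r k ^ (q - p)) := by
    filter_upwards [hr.eventually_ge_atTop (max 1 (1 / c)),
      hz.eventually (gt_mem_nhds (show z₀ < z₀ / 2 by linarith))] with k hk hzk
    have hr0 : 0 < r k := lt_of_lt_of_le one_pos ((le_max_left _ _).trans hk)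
    have hl : 1 ≤ c * r k := by
      have := (le_max_right _ _).trans hk
      rwa [div_le_iff₀' hc] at this
    have e : r k * (z₀ / 2) = (c * r k) * (-n) := by
      simp only [c]; field_simp
    have h1 : V (r k * z k) ω ≤ (c * r k) ^ q * (-1) := by
      refine (h.utility.mono ω (mul_le_mul_of_nonneg_left hzk.le hr0.le)).trans ?_
      rw [e]
      refine (hg _ _ hl).2.trans (mul_le_mul_of_nonneg_left (by linarith) (by positivity))
    rw [div_le_iff₀ (by positivity), neg_mul, mul_assoc, ← Real.rpow_add hr0, sub_add_cancel,
      ← Real.mul_rpow hc.le hr0.le]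
    linarith
  refine tendsto_atBot_mono' _ hbound ?_
  refine tendsto_neg_atTop_atBot.comp ?_
  exact ((tendsto_rpow_atTop (sub_pos.2 hpq)).comp hr).const_mul_atTop (by positivity)

/-- The limit direction of positions with conditional expectations bounded from below has a
nonnegative gain. -/
theorem nonneg_of_tendsto (h : OnePeriod P m Y L p q C V) {X r : ℕ → Ω → ℝ}
    {ξ : ℕ → Ω → EuclideanSpace ℝ (Fin d)} {M x : Ω → ℝ} {η : Ω → EuclideanSpace ℝ (Fin d)}
    {A : Set Ω} (hM : Measurable[m] M) (hr : ∀ n, Measurable[m] (r n)) (hr1 : ∀ n ω, 1 ≤ r n ω)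
    (hXr : ∀ n ω, X n ω ≤ r n ω) (hξr : ∀ n ω, ‖ξ n ω‖ ≤ r n ω)
    (hint : ∀ n, CondIntegrable P m (payoff V Y (X n) (ξ n)))
    (hle : ∀ n, ∀ᵐ ω ∂P, M ω ≤ ce P m (payoff V Y (X n) (ξ n)) ω)
    (hx : ∀ ω, Tendsto (fun n => X n ω / r n ω) atTop (𝓝 (x ω)))
    (hη : ∀ ω, Tendsto (fun n => (r n ω)⁻¹ • ξ n ω) atTop (𝓝 (η ω)))
    (hA : ∀ ω ∈ A, Tendsto (fun n => r n ω) atTop atTop) :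
    ∀ᵐ ω ∂P, ω ∈ A → 0 ≤ x ω + inner ℝ (η ω) (Y ω) := by
  let g := dominant V Y C
  have hgi : CondIntegrable P m g := h.condIntegrable_dominant
  -- After this normalization the payoffs stay below `g`; as the weights are at most `1`, their
  -- conditional expectations stay above `-|M|`.
  let w : ℕ → Ω → ℝ := fun n ω => (r n ω ^ p)⁻¹
  have hw : ∀ n, Measurable[m] (w n) := fun n => ((hr n).pow_const p).inv
  have hw0 : ∀ n ω, 0 < w n ω := fun n ω => by
    have := hr1 n ω
    positivity
  have hw1 : ∀ n ω, w n ω ≤ 1 := fun n ω => inv_le_one_of_one_le₀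
    (Real.one_le_rpow (hr1 n ω) h.p_pos.le)
  let f : ℕ → Ω → ℝ := fun n ω => w n ω * payoff V Y (X n) (ξ n) ω
  have hf : ∀ n, CondIntegrable P m (f n) := fun n => (hint n).mul_left h.le (hw n)
  have hfg : ∀ n, ∀ᵐ ω ∂P, f n ω ≤ g ω := by
    intro n
    filter_upwards [h.payoff_le_dominant] with ω hω
    have h1 : payoff V Y (X n) (ξ n) ω ≤ r n ω ^ p * g ω :=
      hω _ _ _ (hr1 n ω) (hXr n ω) (hξr n ω)
    have h2 : 0 < r n ω ^ p := by
      have := hr1 n ω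
      positivity
    calc f n ω ≤ (r n ω ^ p)⁻¹ * (r n ω ^ p * g ω) :=
          mul_le_mul_of_nonneg_left h1 (hw0 n ω).le
      _ = g ω := inv_mul_cancel_left₀ h2.ne' _
  have hD : Measurable[m] fun ω => ENNReal.ofReal (ce P m g ω + |M ω|) :=
    ((measurable_ce P m g).add (measurable_abs.comp hM)).ennreal_ofReal
  have hfat := condLExp_liminf_le (P := P) h.le (h := fun n ω => ENNReal.ofReal (g ω - f n ω))
    (fun n => (hgi.meas.sub (hf n).meas).ennreal_ofReal) hD (Eventually.of_forall fun n => by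
      filter_upwards [condLExp_ofReal_eq (hgi.sub (hf n)) (by
        filter_upwards [hfg n] with ω h using sub_nonneg.2 h), ce_sub hgi (hf n),
        ce_mul_left h.le (hw n) (hint n), hle n] with ω a1 a2 a3 a4
      rw [a1, a2]
      refine ENNReal.ofReal_le_ofReal ?_
      have a5 : ce P m (f n) ω = w n ω * ce P m (payoff V Y (X n) (ξ n)) ω := a3
      have a6 : -|M ω| ≤ w n ω * ce P m (payoff V Y (X n) (ξ n)) ω := by
        have b1 := mul_le_mul_of_nonneg_left ((neg_abs_le (M ω)).trans a4) (hw0 n ω).le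
        have b2 := mul_le_mul_of_nonneg_right (hw1 n ω) (abs_nonneg (M ω))
        linarith
      linarith)
  -- A finite lower limit of `g - f n` rules out `f n → -∞`, which is what a negative limit gain
  -- would cause.
  have hfin := ae_lt_top_of_condLExp_lt_top (P := P) h.le
    (X := fun ω => liminf (fun n => ENNReal.ofReal (g ω - f n ω)) atTop)
    (Measurable.liminf fun n => (hgi.meas.sub (hf n).meas).ennreal_ofReal)
    (by filter_upwards [hfat] with ω hω using hω.trans_lt ENNReal.ofReal_lt_top)
  filter_upwards [hfin, h.tendsto_div_rpow_atBot] with ω h1 h2 hω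
  by_contra hneg
  rw [not_le] at hneg
  have h3 := h2 (fun n => r n ω) (fun n => X n ω / r n ω + inner ℝ ((r n ω)⁻¹ • ξ n ω) (Y ω))
    _ hneg (hA ω hω) ((hx ω).add ((hη ω).inner tendsto_const_nhds))
  have h4 : Tendsto (fun n => f n ω) atTop atBot := by
    refine h3.congr fun n => ?_
    have hr0 : r n ω ≠ 0 := (zero_lt_one.trans_le (hr1 n ω)).ne'
    simp only [f, w, payoff, inner_smul_left, div_eq_inv_mul]
    congr 3
    simp [mul_add, mul_inv_cancel_left₀ hr0]
  have h5 : Tendsto (fun n => ENNReal.ofReal (g ω - f n ω)) atTop (𝓝 ⊤) :=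
    ENNReal.tendsto_ofReal_atTop.comp
      (tendsto_atTop_add_const_left _ _ (tendsto_neg_atBot_atTop.comp h4))
  rw [h5.liminf_eq] at h1
  exact lt_irrefl _ h1

end OnePeriod

end Compactness
-- Bounded positions and existence of optimal positions
section Optimizer

open Filter Topology
open scoped ENNReal

variable {Ω : Type*} {m mΩ : MeasurableSpace Ω} {P : Measure Ω} [IsProbabilityMeasure P] {d : ℕ}

namespace OnePeriod

variable {Y : Ω → EuclideanSpace ℝ (Fin d)} {L : ℝ → ℝ} {p q C : ℝ} {V : ℝ → Ω → ℝ}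

/-- Positions orthogonal to the ones without gain are bounded as soon as their conditional
expected utilities are bounded from below. -/
theorem ae_bounded (h : OnePeriod P m Y L p q C V) {X : ℕ → Ω → ℝ}
    {ξ : ℕ → Ω → EuclideanSpace ℝ (Fin d)} {M b : Ω → ℝ} (hM : Measurable[m] M)
    (hX : ∀ n, Measurable[m] (X n)) (hξ : ∀ n, Measurable[m] (ξ n))
    (hXb : ∀ n ω, X n ω ≤ b ω)
    (hint : ∀ n, CondIntegrable P m (payoff V Y (X n) (ξ n)))
    (hle : ∀ n, ∀ᵐ ω ∂P, M ω ≤ ce P m (payoff V Y (X n) (ξ n)) ω)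
    (horth : ∀ n, ∀ ν : Ω → EuclideanSpace ℝ (Fin d), Measurable[m] ν →
        (∀ᵐ ω ∂P, inner ℝ (ν ω) (Y ω) = 0) → ∀ᵐ ω ∂P, inner ℝ (ξ n ω) (ν ω) = 0) :
    ∀ᵐ ω ∂P, ∃ K : ℕ, ∀ n, |X n ω| ≤ K ∧ ‖ξ n ω‖ ≤ K := by
  classical
  let r : ℕ → Ω → ℝ := fun n ω => max 1 (max |X n ω| ‖ξ n ω‖)
  have hr : ∀ n, Measurable[m] (r n) := fun n =>
    Measurable.max measurable_const ((measurable_abs.comp (hX n)).max (measurable_norm.comp (hξ n)))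
  have hr1 : ∀ n ω, 1 ≤ r n ω := fun n ω => le_max_left _ _
  -- This is the set where the sizes are unbounded; the goal is that it is null.
  let A : Set Ω := ⋂ K : ℕ, ⋃ n, {ω | (K : ℝ) < r n ω}
  have hAm : MeasurableSet[m] A := by
    refine MeasurableSet.iInter fun K => MeasurableSet.iUnion fun n => ?_
    exact measurableSet_lt measurable_const (hr n)
  -- The condition is vacuous outside `A`, so the first-index search is defined everywhere.
  have hex : ∀ (K : ℕ) (ω : Ω), ∃ n, ω ∈ A → (K : ℝ) < r n ω := by
    intro K ω
    by_cases hω : ω ∈ A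
    · obtain ⟨n, hn⟩ := Set.mem_iUnion.1 (Set.mem_iInter.1 hω K)
      exact ⟨n, fun _ => hn⟩
    · exact ⟨0, fun h => absurd h hω⟩
  let σ : ℕ → Ω → ℕ := fun K ω => Nat.find (hex K ω)
  have hσ : ∀ K, Measurable[m] (σ K) := fun K => by
    refine measurable_find _ fun n => ?_
    have : {ω | ω ∈ A → (K : ℝ) < r n ω} = Aᶜ ∪ {ω | (K : ℝ) < r n ω} := by
      ext ω
      simp [imp_iff_not_or]
    rw [this]
    exact hAm.compl.union (measurableSet_lt measurable_const (hr n))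
  have hσr : ∀ K : ℕ, ∀ ω ∈ A, (K : ℝ) < r (σ K ω) ω := fun K ω hω => Nat.find_spec (hex K ω) hω
  have hrσ : ∀ K, Measurable[m] fun ω => r (σ K ω) ω := fun K => measurable_eval_nat hr (hσ K)
  have hbd : ∀ n ω, |X n ω / r n ω| ≤ 1 ∧ ‖(r n ω)⁻¹ • ξ n ω‖ ≤ 1 := by
    intro n ω
    have h0 : 0 < r n ω := zero_lt_one.trans_le (hr1 n ω)
    rw [abs_div, abs_of_pos h0, div_le_one h0, norm_smul, norm_inv, Real.norm_of_nonneg h0.le,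
      inv_mul_le_one₀ h0]
    exact ⟨(le_max_left _ _).trans (le_max_right _ _), (le_max_right _ _).trans (le_max_right _ _)⟩
  obtain ⟨ρ, x, η, hρm, hρ, hxm, hηm, hx, hη⟩ := exists_measurable_subseq (m := m)
    (X := fun K ω => X (σ K ω) ω / r (σ K ω) ω) (ξ := fun K ω => (r (σ K ω) ω)⁻¹ • ξ (σ K ω) ω)
    (fun K => (measurable_eval_nat hX (hσ K)).div (hrσ K))
    (fun K => (hrσ K).inv.smul (measurable_eval_nat hξ (hσ K)))
    (fun ω => ⟨1, fun K => hbd _ ω⟩)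
  let τ : ℕ → Ω → ℕ := fun k ω => σ (ρ k ω) ω
  have hτ : ∀ k, Measurable[m] (τ k) := fun k => measurable_eval_nat hσ (hρm k)
  have hτr : ∀ k : ℕ, ∀ ω ∈ A, (k : ℝ) < r (τ k ω) ω := fun k ω hω =>
    (Nat.cast_le.2 (hρ k ω)).trans_lt (hσr _ ω hω)
  have hτA : ∀ ω ∈ A, Tendsto (fun k => r (τ k ω) ω) atTop atTop := fun ω hω =>
    tendsto_atTop_mono (fun k => (hτr k ω hω).le) tendsto_natCast_atTop_atTop
  have hnn : ∀ᵐ ω ∂P, ω ∈ A → 0 ≤ x ω + inner ℝ (η ω) (Y ω) := by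
    refine h.nonneg_of_tendsto (X := fun k ω => X (τ k ω) ω) (ξ := fun k ω => ξ (τ k ω) ω)
      (r := fun k ω => r (τ k ω) ω) hM (fun k => measurable_eval_nat hr (hτ k))
      (fun k ω => hr1 _ ω) (fun k ω => ?_) (fun k ω => ?_) (fun k => ?_) (fun k => ?_) hx hη hτA
    · exact (le_abs_self _).trans ((le_max_left _ _).trans (le_max_right _ _))
    · exact (le_max_right _ _).trans (le_max_right _ _)
    · exact CondIntegrable.random_index h.le hint (hτ k)
    · filter_upwards [ce_random_index h.le hint (hτ k), ae_all_iff.2 hle] with ω h1 h2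
      have h3 : ce P m (payoff V Y (fun ω => X (τ k ω) ω) fun ω => ξ (τ k ω) ω) ω =
        ce P m (payoff V Y (X (τ k ω)) (ξ (τ k ω))) ω := h1
      rw [h3]
      exact h2 _
  -- Wealth is bounded above by `b`, which does not depend on `n`, so the normalized wealth has a
  -- nonpositive limit. The limit position alone must then make up a nonnegative total and is
  -- subject to no-arbitrage.
  have hxle : ∀ ω ∈ A, x ω ≤ 0 := by
    intro ω hω
    have h1 : Tendsto (fun k => |b ω| / r (τ k ω) ω) atTop (𝓝 0) :=
      tendsto_const_nhds.div_atTop (hτA ω hω)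
    refine le_of_tendsto_of_tendsto' (hx ω) h1 fun k => ?_
    exact div_le_div_of_nonneg_right ((hXb _ ω).trans (le_abs_self _))
      (zero_le_one.trans (hr1 _ ω))
  let η' : Ω → EuclideanSpace ℝ (Fin d) := A.indicator η
  have hη'm : Measurable[m] η' := hηm.indicator hAm
  have hη'0 : ∀ᵐ ω ∂P, inner ℝ (η' ω) (Y ω) = 0 := by
    refine h.noArbitrage η' hη'm ?_
    filter_upwards [hnn] with ω hω
    by_cases hA : ω ∈ A
    · have := hxle ω hA
      have := hω hA
      simp only [η', Set.indicator_of_mem hA]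
      linarith
    · simp [η', hA]
  have hnot : ∀ᵐ ω ∂P, ω ∉ A := by
    filter_upwards [hnn, hη'0, ae_all_iff.2 fun n => horth n η' hη'm hη'0] with ω h1 h2 h3 hA
    have e : η' ω = η ω := Set.indicator_of_mem hA _
    rw [e] at h2
    have hx0 : x ω = 0 := le_antisymm (hxle ω hA) (by linarith [h1 hA])
    -- Each position is orthogonal to the zero-gain position `η'`; in the limit `η` is orthogonal to
    -- itself.
    have hη0 : η ω = 0 := by
      have h4 : Tendsto (fun _ : ℕ => (0 : ℝ)) atTop (𝓝 (inner ℝ (η ω) (η' ω))) := by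
        refine ((hη ω).inner (tendsto_const_nhds (x := η' ω))).congr fun k => ?_
        rw [inner_smul_left, h3, mul_zero]
      rw [e] at h4
      exact inner_self_eq_zero.1 (tendsto_nhds_unique h4 tendsto_const_nhds)
    -- The normalized pairs have size at least `1` once `r > 1`, but both limits vanish: a
    -- contradiction on `A`.
    have h5 : Tendsto (fun k => max |X (τ k ω) ω / r (τ k ω) ω| ‖(r (τ k ω) ω)⁻¹ • ξ (τ k ω) ω‖)
        atTop (𝓝 (max |x ω| ‖η ω‖)) := (hx ω).abs.max (hη ω).norm
    rw [hx0, hη0, abs_zero, norm_zero, max_self] at h5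
    have h6 : ∀ᶠ k in atTop,
        1 ≤ max |X (τ k ω) ω / r (τ k ω) ω| ‖(r (τ k ω) ω)⁻¹ • ξ (τ k ω) ω‖ := by
      filter_upwards [eventually_ge_atTop 1] with k hk
      have h7 : 1 < r (τ k ω) ω := lt_of_le_of_lt (by exact_mod_cast hk) (hτr k ω hA)
      have h0 : 0 < r (τ k ω) ω := zero_lt_one.trans h7
      rw [abs_div, abs_of_pos h0, norm_smul, norm_inv, Real.norm_of_nonneg h0.le,
        ← div_eq_inv_mul, le_max_iff, one_le_div h0, one_le_div h0, ← le_max_iff]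
      rcases le_max_iff.1 (le_refl (r (τ k ω) ω)) with h8 | h8
      · exact absurd h8 (not_le.2 h7)
      · exact h8
    exact absurd (ge_of_tendsto h5 h6) (by norm_num)
  filter_upwards [hnot] with ω hω
  have : ∃ K : ℕ, ∀ n, r n ω ≤ K := by
    by_contra hcon
    push Not at hcon
    exact hω (Set.mem_iInter.2 fun K => Set.mem_iUnion.2 (hcon K))
  obtain ⟨K, hK⟩ := this
  exact ⟨K, fun n => ⟨((le_max_left _ _).trans (le_max_right _ _)).trans (hK n),
    ((le_max_right _ _).trans (le_max_right _ _)).trans (hK n)⟩⟩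

/-- The positions for which the conditional expected utility from wealth `X` is finite. -/
def positions (P : Measure[mΩ] Ω) (m : MeasurableSpace Ω) (V : ℝ → Ω → ℝ)
    (Y : Ω → EuclideanSpace ℝ (Fin d)) (X : Ω → ℝ) : Set (Ω → EuclideanSpace ℝ (Fin d)) :=
  {ξ | Measurable[m] ξ ∧ CondIntegrable P m (payoff V Y X ξ)}

theorem zero_mem_positions (h : OnePeriod P m Y L p q C V) {X : Ω → ℝ}
    (hX : Measurable[m] X) : 0 ∈ positions P m V Y X :=
  ⟨measurable_const, h.condIntegrable_eval hX⟩

theorem piecewise_mem_positions (h : OnePeriod P m Y L p q C V) {X : Ω → ℝ}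
    (hX : Measurable[m] X) {ξ ξ' : Ω → EuclideanSpace ℝ (Fin d)}
    (hξ : ξ ∈ positions P m V Y X) (hξ' : ξ' ∈ positions P m V Y X) {A : Set Ω}
    [∀ ω, Decidable (ω ∈ A)] (hA : MeasurableSet[m] A) :
    A.piecewise ξ ξ' ∈ positions P m V Y X ∧
    ∀ᵐ ω ∂P, ce P m (payoff V Y X (A.piecewise ξ ξ')) ω =
      A.piecewise (ce P m (payoff V Y X ξ)) (ce P m (payoff V Y X ξ')) ω := by
  have hmeas : Measurable[m] (A.piecewise ξ ξ') := hξ.1.piecewise hA hξ'.1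
  have hint : CondIntegrable P m (payoff V Y X (A.piecewise ξ ξ')) := by
    refine CondIntegrable.of_cover h.le
      (h.measurable_payoff (hX.mono h.le le_rfl) (hmeas.mono h.le le_rfl))
      (g := fun n => if n = 0 then payoff V Y X ξ else payoff V Y X ξ')
      (fun n => by split_ifs; exacts [hξ.2, hξ'.2]) (A := fun n => if n = 0 then A else Aᶜ)
      (fun n => by split_ifs; exacts [hA, hA.compl]) (fun ω => ?_) (fun n => ae_of_all _ ?_)
    · by_cases hω : ω ∈ A
      · exact ⟨0, by simpa using hω⟩
      · exact ⟨1, by simpa using hω⟩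
    · intro ω
      by_cases hn : n = 0
      · simp only [hn, if_true]
        intro hω
        simp [payoff, hω]
      · simp only [hn, if_false]
        intro hω
        simp [payoff, Set.piecewise_eq_of_notMem _ _ _ hω]
  refine ⟨⟨hmeas, hint⟩, ?_⟩
  filter_upwards [ce_congr_on h.le hint hξ.2 hA (ae_of_all _ fun ω hω => by simp [payoff, hω]),
    ce_congr_on h.le hint hξ'.2 hA.compl (ae_of_all _ fun ω hω => by
      simp [payoff, Set.piecewise_eq_of_notMem _ _ _ hω])] with ω h1 h2
  by_cases hω : ω ∈ A
  · rw [h1 hω, Set.piecewise_eq_of_mem _ _ _ hω]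
  · rw [h2 hω, Set.piecewise_eq_of_notMem _ _ _ hω]

/-- The better position is followed on an `m`-measurable set, so the conditional utilities form an
upward directed family. -/
theorem exists_max_position (h : OnePeriod P m Y L p q C V) {X : Ω → ℝ}
    (hX : Measurable[m] X) {ξ ξ' : Ω → EuclideanSpace ℝ (Fin d)}
    (hξ : ξ ∈ positions P m V Y X) (hξ' : ξ' ∈ positions P m V Y X) :
    ∃ ζ ∈ positions P m V Y X, ∀ᵐ ω ∂P, ce P m (payoff V Y X ζ) ω =
      max (ce P m (payoff V Y X ξ) ω) (ce P m (payoff V Y X ξ') ω) := by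
  classical
  have hA : MeasurableSet[m] {ω | ce P m (payoff V Y X ξ') ω ≤ ce P m (payoff V Y X ξ) ω} :=
    measurableSet_le (measurable_ce _ _ _) (measurable_ce _ _ _)
  obtain ⟨h1, h2⟩ := h.piecewise_mem_positions hX hξ hξ' hA
  refine ⟨_, h1, ?_⟩
  filter_upwards [h2] with ω h2
  rw [h2]
  by_cases hω : ce P m (payoff V Y X ξ') ω ≤ ce P m (payoff V Y X ξ) ω
  · rw [max_eq_left hω]
    exact Set.piecewise_eq_of_mem _ _ _ hω
  · rw [max_eq_right (not_le.1 hω).le]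
    exact Set.piecewise_eq_of_notMem _ _ _ hω

/-- Positions can be replaced by ones orthogonal to all positions without gain. -/
theorem exists_orthogonal_mem_positions (h : OnePeriod P m Y L p q C V) {X : Ω → ℝ}
    (hX : Measurable[m] X) {ξ : Ω → EuclideanSpace ℝ (Fin d)} (hξ : ξ ∈ positions P m V Y X) :
    ∃ ξ' ∈ positions P m V Y X,
      (∀ᵐ ω ∂P, ce P m (payoff V Y X ξ') ω = ce P m (payoff V Y X ξ) ω) ∧
      ∀ ν : Ω → EuclideanSpace ℝ (Fin d), Measurable[m] ν →
        (∀ᵐ ω ∂P, inner ℝ (ν ω) (Y ω) = 0) → ∀ᵐ ω ∂P, inner ℝ (ξ' ω) (ν ω) = 0 := by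
  obtain ⟨ξ', hm, hY, ho⟩ := exists_orthogonal_position (P := P) (Y := Y) h.le hξ.1
  have hpay : payoff V Y X ξ' =ᵐ[P] payoff V Y X ξ := by
    filter_upwards [hY] with ω hω
    simp only [payoff, hω]
  refine ⟨ξ', ⟨hm, hξ.2.mono (h.measurable_payoff (hX.mono h.le le_rfl) (hm.mono h.le le_rfl)) ?_⟩,
    ce_congr hpay, ho⟩
  filter_upwards [hpay] with ω hω
  rw [hω]

/-- From a nondecreasing sequence of positions one obtains a position that is at least as good. -/
theorem exists_limit_position (h : OnePeriod P m Y L p q C V) {X : Ω → ℝ}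
    (hX : Measurable[m] X) {ξ : ℕ → Ω → EuclideanSpace ℝ (Fin d)}
    (hξ : ∀ n, ξ n ∈ positions P m V Y X)
    (hmono : ∀ᵐ ω ∂P, Monotone fun n => ce P m (payoff V Y X (ξ n)) ω) :
    ∃ ζ ∈ positions P m V Y X, ∀ n, ∀ᵐ ω ∂P,
      ce P m (payoff V Y X (ξ n)) ω ≤ ce P m (payoff V Y X ζ) ω := by
  choose ξ' hξ' hce hξ'o using fun n => h.exists_orthogonal_mem_positions hX (hξ n)
  have hξ'm : ∀ n, Measurable[m] (ξ' n) := fun n => (hξ' n).1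
  have hint' : ∀ n, CondIntegrable P m (payoff V Y X (ξ' n)) := fun n => (hξ' n).2
  have hbdd := h.ae_bounded (X := fun _ => X) (ξ := ξ') (M := ce P m (payoff V Y X (ξ 0))) (b := X)
    (measurable_ce _ _ _) (fun _ => hX) hξ'm (fun _ _ => le_rfl) hint' (fun n => by
      filter_upwards [hmono, hce n] with ω h1 h2
      rw [h2]
      exact h1 (Nat.zero_le n)) hξ'o
  -- Subsequence extraction needs bounds at every point. Completeness makes `N` an element of `m`,
  -- and the positions are set to zero outside it.
  let N : Set Ω := {ω | ∃ K : ℕ, ∀ n, |X ω| ≤ K ∧ ‖ξ' n ω‖ ≤ K}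
  have hN : MeasurableSet[m] N := by
    have : Nᶜ ∈ {s : Set Ω | MeasurableSet[m] s} := h.complete _ hbdd
    simpa using MeasurableSet.compl (show MeasurableSet[m] Nᶜ from this)
  let ζ : ℕ → Ω → EuclideanSpace ℝ (Fin d) := fun n => N.indicator (ξ' n)
  have hζm : ∀ n, Measurable[m] (ζ n) := fun n => (hξ'm n).indicator hN
  have hζb : ∀ ω, ∃ K : ℝ, ∀ n, ‖ζ n ω‖ ≤ K := by
    intro ω
    by_cases hω : ω ∈ N
    · obtain ⟨K, hK⟩ := id hω
      exact ⟨K, fun n => by simpa [ζ, hω] using (hK n).2⟩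
    · exact ⟨0, fun n => by simp [ζ, hω]⟩
  have hpay' : ∀ n, payoff V Y X (ζ n) =ᵐ[P] payoff V Y X (ξ' n) := fun n => by
    filter_upwards [hbdd] with ω hω
    simp only [payoff, ζ, Set.indicator_of_mem (show ω ∈ N from hω)]
  have hint : ∀ n, CondIntegrable P m (payoff V Y X (ζ n)) := fun n =>
    (hint' n).mono (h.measurable_payoff (hX.mono h.le le_rfl) ((hζm n).mono h.le le_rfl)) (by
      filter_upwards [hpay' n] with ω hω
      rw [hω])
  have hce' : ∀ n, ∀ᵐ ω ∂P, ce P m (payoff V Y X (ζ n)) ω = ce P m (payoff V Y X (ξ n)) ω :=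
    fun n => by filter_upwards [ce_congr (m := m) (hpay' n), hce n] with ω h1 h2 using h1.trans h2
  obtain ⟨τ, x, η, hτm, hτ, -, hηm, -, hη⟩ := exists_measurable_subseq (m := m)
    (X := fun _ _ => 0) (ξ := ζ) (fun _ => measurable_const) hζm (fun ω => by
      obtain ⟨K, hK⟩ := hζb ω
      exact ⟨K, fun n => ⟨by simpa using (norm_nonneg _).trans (hK n), hK n⟩⟩)
  -- An `m`-measurable random radius containing wealth and all positions, so that `R ^ p` times the
  -- dominant is one conditionally integrable bound for the whole sequence.
  let R : Ω → ℝ := fun ω => 1 + |X ω| + ⨆ n, ‖ζ n ω‖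
  have hRm : Measurable[m] R := (measurable_const.add (measurable_abs.comp hX)).add
    (Measurable.iSup fun n => measurable_norm.comp (hζm n))
  have hζR : ∀ n ω, ‖ζ n ω‖ ≤ ⨆ n, ‖ζ n ω‖ := fun n ω => by
    obtain ⟨K, hK⟩ := hζb ω
    exact le_ciSup (f := fun n => ‖ζ n ω‖) ⟨K, by rintro _ ⟨n, rfl⟩; exact hK n⟩ n
  have key : ∀ j, CondIntegrable P m (payoff V Y X η) ∧
      ∀ᵐ ω ∂P, ce P m (payoff V Y X (ξ j)) ω ≤ ce P m (payoff V Y X η) ω := by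
    intro j
    refine CondIntegrable.of_tendsto h.le (f := fun k ω => payoff V Y X (ζ (τ k ω)) ω)
      (G := fun ω => R ω ^ p * dominant V Y C ω)
      (fun k => CondIntegrable.random_index h.le hint (hτm k))
      (h.condIntegrable_dominant.mul_left h.le (hRm.pow_const p))
      (h.measurable_payoff (hX.mono h.le le_rfl) (hηm.mono h.le le_rfl)) (measurable_ce _ _ _)
      (fun k => ?_) (ae_of_all _ fun ω => ?_) ?_
    · filter_upwards [h.payoff_le_dominant] with ω hω
      have h0 := (norm_nonneg _).trans (hζR 0 ω)
      refine hω _ _ _ ?_ ?_ ?_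
      · linarith [abs_nonneg (X ω)]
      · linarith [le_abs_self (X ω)]
      · linarith [hζR (τ k ω) ω, abs_nonneg (X ω)]
    · exact ((h.utility.continuous ω).tendsto _).comp
        (tendsto_const_nhds.add ((hη ω).inner tendsto_const_nhds))
    · filter_upwards [eventually_ge_atTop j] with k hk
      filter_upwards [ce_random_index h.le hint (hτm k), hmono, ae_all_iff.2 hce'] with ω h1 h2 h3
      rw [h1, h3]
      exact h2 (hk.trans (hτ k ω))
  exact ⟨η, ⟨hηm, (key 0).1⟩, fun j => (key j).2⟩

/-- Existence of an optimal position from every initial wealth. -/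
theorem exists_optimal_position (h : OnePeriod P m Y L p q C V) {X : Ω → ℝ}
    (hX : Measurable[m] X) :
    ∃ ξ ∈ positions P m V Y X, ∀ ξ' ∈ positions P m V Y X, ∀ᵐ ω ∂P,
      ce P m (payoff V Y X ξ') ω ≤ ce P m (payoff V Y X ξ) ω := by
  -- A bounded strictly increasing transform: maximizing its expectation is always meaningful and
  -- detects almost sure maximality.
  let κ : (Ω → EuclideanSpace ℝ (Fin d)) → Ω → ℝ := fun ξ ω =>
    Real.arctan (ce P m (payoff V Y X ξ) ω)
  let I : (Ω → EuclideanSpace ℝ (Fin d)) → ℝ := fun ξ => ∫ ω, κ ξ ω ∂P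
  have hκb : ∀ ξ ω, |κ ξ ω| ≤ Real.pi / 2 := fun ξ ω =>
    abs_le.2 ⟨(Real.neg_pi_div_two_lt_arctan _).le, (Real.arctan_lt_pi_div_two _).le⟩
  have hκi : ∀ ξ, Integrable (κ ξ) P := fun ξ => by
    refine Integrable.of_bound (C := Real.pi / 2) ?_ (ae_of_all _ (hκb ξ))
    exact (Real.continuous_arctan.measurable.comp
      ((measurable_ce P m _).mono h.le le_rfl)).aestronglyMeasurable
  have hImono : ∀ ξ ξ', (∀ᵐ ω ∂P, ce P m (payoff V Y X ξ) ω ≤ ce P m (payoff V Y X ξ') ω) →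
      I ξ ≤ I ξ' := fun ξ ξ' hle =>
    integral_mono_ae (hκi ξ) (hκi ξ') (by
      filter_upwards [hle] with ω hω using Real.arctan_strictMono.monotone hω)
  let s := sSup (I '' positions P m V Y X)
  have hne : (I '' positions P m V Y X).Nonempty := ⟨_, _, h.zero_mem_positions hX, rfl⟩
  have hbdd : BddAbove (I '' positions P m V Y X) := by
    refine ⟨Real.pi / 2, ?_⟩
    rintro _ ⟨ξ, -, rfl⟩
    have := integral_mono (hκi ξ) (integrable_const (Real.pi / 2))
      (fun ω => (abs_le.1 (hκb ξ ω)).2)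
    simpa using this
  have hseq : ∀ n : ℕ, ∃ ξ ∈ positions P m V Y X, s - 1 / ((n : ℝ) + 1) < I ξ := by
    intro n
    obtain ⟨_, ⟨ξ, hξ, rfl⟩, hlt⟩ := exists_lt_of_lt_csSup hne
      (show s - 1 / ((n : ℝ) + 1) < s from sub_lt_self _ (by positivity))
    exact ⟨ξ, hξ, hlt⟩
  choose a ha hIa using hseq
  choose j hj hjmax using fun (ξ ξ' : positions P m V Y X) =>
    h.exists_max_position hX ξ.2 ξ'.2
  -- Running maxima of a maximizing sequence, so that the conditional utilities increase.
  let b : ℕ → positions P m V Y X := fun n =>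
    Nat.rec ⟨a 0, ha 0⟩ (fun n ξ => ⟨j ξ ⟨a (n + 1), ha (n + 1)⟩, hj _ _⟩) n
  have hbs : ∀ n, ∀ᵐ ω ∂P, ce P m (payoff V Y X (b (n + 1)).1) ω =
      max (ce P m (payoff V Y X (b n).1) ω) (ce P m (payoff V Y X (a (n + 1))) ω) :=
    fun n => hjmax (b n) ⟨a (n + 1), ha (n + 1)⟩
  have hbmono : ∀ᵐ ω ∂P, Monotone fun n => ce P m (payoff V Y X (b n).1) ω := by
    filter_upwards [ae_all_iff.2 hbs] with ω hω
    exact monotone_nat_of_le_succ fun n => by rw [hω n]; exact le_max_left _ _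
  have hba : ∀ n, I (a n) ≤ I (b n).1 := by
    intro n
    cases n with
    | zero => exact le_rfl
    | succ n =>
      refine hImono _ _ ?_
      filter_upwards [hbs n] with ω hω
      rw [hω]
      exact le_max_right _ _
  obtain ⟨ξ, hξ, hξb⟩ := h.exists_limit_position hX (fun n => (b n).2) hbmono
  have hIξ : s ≤ I ξ := by
    have : Tendsto (fun n : ℕ => s - 1 / ((n : ℝ) + 1)) atTop (𝓝 (s - 0)) :=
      tendsto_const_nhds.sub tendsto_one_div_add_atTop_nhds_zero_nat
    rw [sub_zero] at this
    exact le_of_tendsto' this fun n => (hIa n).le.trans ((hba n).trans (hImono _ _ (hξb n)))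
  refine ⟨ξ, hξ, fun ξ' hξ' => ?_⟩
  obtain ⟨ζ, hζ, hζmax⟩ := h.exists_max_position hX hξ hξ'
  have h1 : I ζ ≤ I ξ := (le_csSup hbdd ⟨ζ, hζ, rfl⟩).trans hIξ
  have hle : κ ξ ≤ᵐ[P] κ ζ := by
    filter_upwards [hζmax] with ω hω
    refine Real.arctan_strictMono.monotone ?_
    rw [hω]
    exact le_max_left _ _
  -- The maximum of `ξ` and any competitor cannot have a larger expectation; being pointwise at
  -- least as large, it coincides with `ξ`'s value almost surely.
  have h2 : κ ξ =ᵐ[P] κ ζ := by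
    exact (integral_eq_iff_of_ae_le (hκi _) (hκi _) hle).1 (le_antisymm (hImono _ _ (by
      filter_upwards [hζmax] with ω hω
      rw [hω]
      exact le_max_left _ _)) h1)
  filter_upwards [h2, hζmax] with ω h3 h4
  rw [Real.arctan_strictMono.injective h3, h4]
  exact le_max_right _ _

end OnePeriod

end Optimizer
-- Versions with nondecreasing concave paths
section Regularization

open Filter Topology
open scoped ENNReal

/-- The left-continuous extension of a function on the rationals. -/
noncomputable def leftExtension (f : ℚ → ℝ) (x : ℝ) : ℝ :=
  ⨆ r : {r : ℚ // (r : ℝ) < x}, f r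

theorem exists_rat_seq_left (x : ℝ) :
    ∃ u : ℕ → ℚ, (∀ n, (u n : ℝ) < x) ∧ Tendsto (fun n => (u n : ℝ)) atTop (𝓝 x) := by
  have : ∀ n : ℕ, ∃ r : ℚ, x - 1 / ((n : ℝ) + 1) < r ∧ (r : ℝ) < x := fun n =>
    exists_rat_btwn (sub_lt_self _ (by positivity))
  choose u hu using this
  refine ⟨u, fun n => (hu n).2, ?_⟩
  have h1 : Tendsto (fun n : ℕ => x - 1 / ((n : ℝ) + 1)) atTop (𝓝 (x - 0)) :=
    tendsto_const_nhds.sub tendsto_one_div_add_atTop_nhds_zero_nat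
  rw [sub_zero] at h1
  exact tendsto_of_tendsto_of_tendsto_of_le_of_le h1 tendsto_const_nhds (fun n => (hu n).1.le)
    fun n => (hu n).2.le

theorem exists_rat_seq_right (x : ℝ) :
    ∃ u : ℕ → ℚ, (∀ n, x < (u n : ℝ)) ∧ Tendsto (fun n => (u n : ℝ)) atTop (𝓝 x) := by
  obtain ⟨u, h1, h2⟩ := exists_rat_seq_left (-x)
  refine ⟨fun n => - u n, fun n => ?_, ?_⟩
  · push_cast
    linarith [h1 n]
  · simpa using h2.neg

section Deterministic

variable {f : ℚ → ℝ}

theorem le_leftExtension (hf : Monotone f) {r : ℚ} {x : ℝ} (hr : (r : ℝ) < x) : f r ≤ leftExtension f x := by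
  obtain ⟨s, hs⟩ := exists_rat_gt x
  refine le_ciSup (f := fun r : {r : ℚ // (r : ℝ) < x} => f r) ⟨f s, ?_⟩ ⟨r, hr⟩
  rintro _ ⟨t, rfl⟩
  exact hf (by exact_mod_cast (t.2.trans hs).le)

theorem leftExtension_le {c x : ℝ} (h : ∀ r : ℚ, (r : ℝ) < x → f r ≤ c) :
    leftExtension f x ≤ c := by
  obtain ⟨s, hs⟩ := exists_rat_lt x
  have : Nonempty {r : ℚ // (r : ℝ) < x} := ⟨⟨s, hs⟩⟩
  exact ciSup_le fun r => h r r.2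

theorem monotone_leftExtension (hf : Monotone f) : Monotone (leftExtension f) := fun _ _ hxy =>
  leftExtension_le fun _ hr => le_leftExtension hf (hr.trans_le hxy)

theorem tendsto_leftExtension (hf : Monotone f) {x : ℝ} {u : ℕ → ℚ} (hu : ∀ n, (u n : ℝ) < x)
    (hux : Tendsto (fun n => (u n : ℝ)) atTop (𝓝 x)) :
    Tendsto (fun n => f (u n)) atTop (𝓝 (leftExtension f x)) := by
  refine tendsto_order.2 ⟨fun a ha => ?_, fun a ha => Eventually.of_forall fun n =>
    (le_leftExtension hf (hu n)).trans_lt ha⟩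
  have : ∃ r : ℚ, (r : ℝ) < x ∧ a < f r := by
    by_contra hcon
    push Not at hcon
    exact absurd (leftExtension_le hcon) (not_le.2 ha)
  obtain ⟨r, hr, har⟩ := this
  filter_upwards [hux.eventually (lt_mem_nhds hr)] with n hn
  exact har.trans_le (hf (by exact_mod_cast hn.le))

theorem concaveOn_leftExtension (hf : Monotone f) (hc : ∀ x y z : ℚ, x < y → y < z →
    ((z : ℝ) - y) * f x + ((y : ℝ) - x) * f z ≤ ((z : ℝ) - x) * f y) :
    ConcaveOn ℝ Set.univ (leftExtension f) := by
  have key : ∀ x y z : ℝ, x < y → y < z →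
      (z - y) * leftExtension f x + (y - x) * leftExtension f z ≤ (z - x) * leftExtension f y := by
    intro x y z hxy hyz
    obtain ⟨u, hu, hux⟩ := exists_rat_seq_left x
    obtain ⟨v, hv, hvy⟩ := exists_rat_seq_left y
    obtain ⟨w, hw, hwz⟩ := exists_rat_seq_left z
    refine le_of_tendsto_of_tendsto
      (((hwz.sub hvy).mul (tendsto_leftExtension hf hu hux)).add
        ((hvy.sub hux).mul (tendsto_leftExtension hf hw hwz)))
      ((hwz.sub hux).mul (tendsto_leftExtension hf hv hvy)) ?_
    filter_upwards [hux.eventually_lt hvy hxy, hvy.eventually_lt hwz hyz] with n h1 h2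
    exact hc _ _ _ (by exact_mod_cast h1) (by exact_mod_cast h2)
  refine concaveOn_of_slope_anti_adjacent convex_univ fun {x y z} _ _ hxy hyz => ?_
  rw [div_le_div_iff₀ (by linarith) (by linarith)]
  have := key x y z hxy hyz
  nlinarith

end Deterministic

variable {Ω : Type*} {m mΩ : MeasurableSpace Ω} {P : Measure Ω}

/-- A family of random variables that is almost surely nondecreasing and concave in the parameter
has a version with nondecreasing and concave paths. -/
theorem exists_regular_version (hcomp : ∀ N : Set Ω, P N = 0 → MeasurableSet[m] N)
    {w : ℝ → Ω → ℝ} (hw : ∀ x, Measurable[m] (w x))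
    (hmono : ∀ x y, x ≤ y → ∀ᵐ ω ∂P, w x ω ≤ w y ω)
    (hconc : ∀ x y z, x < y → y < z →
      ∀ᵐ ω ∂P, (z - y) * w x ω + (y - x) * w z ω ≤ (z - x) * w y ω) :
    ∃ W : ℝ → Ω → ℝ, (∀ x, Measurable[m] (W x)) ∧ (∀ ω, Monotone fun x => W x ω) ∧
      (∀ ω, ConcaveOn ℝ Set.univ fun x => W x ω) ∧ ∀ x, ∀ᵐ ω ∂P, W x ω = w x ω := by
  classical
  let N : Set Ω := {ω | (Monotone fun r : ℚ => w r ω) ∧ ∀ x y z : ℚ, x < y → y < z →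
    ((z : ℝ) - y) * w x ω + ((y : ℝ) - x) * w z ω ≤ ((z : ℝ) - x) * w y ω}
  have hN : ∀ᵐ ω ∂P, ω ∈ N := by
    have h1 : ∀ᵐ ω ∂P, ∀ x y : ℚ, x ≤ y → w x ω ≤ w y ω := by
      refine ae_all_iff.2 fun x => ae_all_iff.2 fun y => ?_
      by_cases hxy : x ≤ y
      · filter_upwards [hmono x y (by exact_mod_cast hxy)] with ω hω _ using hω
      · exact ae_of_all _ fun ω h => absurd h hxy
    have h2 : ∀ᵐ ω ∂P, ∀ x y z : ℚ, x < y → y < z →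
        ((z : ℝ) - y) * w x ω + ((y : ℝ) - x) * w z ω ≤ ((z : ℝ) - x) * w y ω := by
      refine ae_all_iff.2 fun x => ae_all_iff.2 fun y => ae_all_iff.2 fun z => ?_
      by_cases hxy : x < y
      · by_cases hyz : y < z
        · filter_upwards [hconc x y z (by exact_mod_cast hxy) (by exact_mod_cast hyz)] with ω hω _ _
            using hω
        · exact ae_of_all _ fun ω _ h => absurd h hyz
      · exact ae_of_all _ fun ω h => absurd h hxy
    filter_upwards [h1, h2] with ω h1 h2 using ⟨fun x y hxy => h1 x y hxy, h2⟩
  have hNm : MeasurableSet[m] N := by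
    have : MeasurableSet[m] Nᶜ := hcomp _ hN
    simpa using this.compl
  refine ⟨fun x => N.indicator fun ω => leftExtension (fun r => w r ω) x, fun x => ?_, fun ω => ?_,
    fun ω => ?_, fun x => ?_⟩
  · exact (Measurable.iSup fun r : {r : ℚ // (r : ℝ) < x} => hw r).indicator hNm
  · by_cases hω : ω ∈ N
    · simpa [hω] using monotone_leftExtension hω.1
    · simpa [hω] using monotone_const
  · by_cases hω : ω ∈ N
    · simpa [hω] using concaveOn_leftExtension hω.1 hω.2
    · simpa [hω] using concaveOn_const 0 convex_univ
  · have h1 : ∀ᵐ ω ∂P, ∀ r : ℚ, (r : ℝ) < x → w r ω ≤ w x ω := by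
      refine ae_all_iff.2 fun r => ?_
      by_cases hr : (r : ℝ) < x
      · filter_upwards [hmono r x hr.le] with ω hω _ using hω
      · exact ae_of_all _ fun ω h => absurd h hr
    have h2 : ∀ᵐ ω ∂P, ∀ r : ℚ, x < (r : ℝ) → w x ω ≤ w r ω := by
      refine ae_all_iff.2 fun r => ?_
      by_cases hr : x < (r : ℝ)
      · filter_upwards [hmono x r hr.le] with ω hω _ using hω
      · exact ae_of_all _ fun ω h => absurd h hr
    filter_upwards [hN, h1, h2] with ω hω h1 h2
    rw [Set.indicator_of_mem hω]
    refine le_antisymm (leftExtension_le h1) ?_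
    obtain ⟨u, hu, hux⟩ := exists_rat_seq_right x
    have hc := continuous_of_concaveOn_univ (concaveOn_leftExtension hω.1 hω.2)
    -- The extension only sees rationals strictly to the left. Evaluating it at `2 u n - x > u n`
    -- bounds `w (u n)`, hence `w x`, and continuity lets these points tend to `x`.
    have h3 : Tendsto (fun n => (u n : ℝ) + ((u n : ℝ) - x)) atTop (𝓝 x) := by
      simpa using hux.add (hux.sub (tendsto_const_nhds (x := x)))
    refine ge_of_tendsto' ((hc.tendsto x).comp h3) fun n => (h2 _ (hu n)).trans ?_
    exact le_leftExtension hω.1 (by linarith [hu n])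

end Regularization
-- The one-period value function and inheritance of its structure
section ValueFunction

open Filter Topology
open scoped ENNReal

variable {Ω : Type*} {m mΩ : MeasurableSpace Ω} {P : Measure Ω} [IsProbabilityMeasure P] {d : ℕ}

theorem le_of_forall_rat_le {F G : ℝ → ℝ} (hF : Continuous F) (hG : Continuous G)
    (h : ∀ r : ℚ, F r ≤ G r) (x : ℝ) : F x ≤ G x := by
  obtain ⟨u, -, hux⟩ := exists_rat_seq_right x
  exact le_of_tendsto_of_tendsto' ((hF.tendsto x).comp hux) ((hG.tendsto x).comp hux) fun n => h _

theorem growth_of_forall_rat {F : ℝ → ℝ} (hF : Continuous F) {e C : ℝ}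
    (h : ∀ x l : ℚ, 1 ≤ l → F (l * x) ≤ (l : ℝ) ^ e * (F x + C)) (x l : ℝ) (hl : 1 ≤ l) :
    F (l * x) ≤ l ^ e * (F x + C) := by
  obtain ⟨u, hu, hul⟩ := exists_rat_seq_right l
  refine le_of_forall_rat_le (F := fun x => F (l * x)) (G := fun x => l ^ e * (F x + C))
    (by fun_prop) (by fun_prop) (fun r => ?_) x
  refine le_of_tendsto_of_tendsto' ((hF.tendsto _).comp (hul.mul_const (r : ℝ)))
    ((hul.rpow_const (Or.inl (by linarith))).mul_const _) fun n => ?_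
  exact h r (u n) (by exact_mod_cast hl.trans (hu n).le)

namespace OnePeriod

variable {Y : Ω → EuclideanSpace ℝ (Fin d)} {L : ℝ → ℝ} {p q C : ℝ} {V : ℝ → Ω → ℝ}

/-- Higher initial wealth allows positions that are at least as good. -/
theorem exists_position_of_le (h : OnePeriod P m Y L p q C V) {X X' : Ω → ℝ}
    (hX : Measurable[m] X) (hX' : Measurable[m] X') {ξ : Ω → EuclideanSpace ℝ (Fin d)}
    (hξ : ξ ∈ positions P m V Y X) :
    ∃ ξ' ∈ positions P m V Y X', ∀ᵐ ω ∂P, X ω ≤ X' ω →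
      ce P m (payoff V Y X ξ) ω ≤ ce P m (payoff V Y X' ξ') ω := by
  let A : Set Ω := {ω | X ω ≤ X' ω}
  have hA : MeasurableSet[m] A := measurableSet_le hX hX'
  -- Where the new wealth is smaller nothing is claimed; the zero position there keeps the payoff
  -- conditionally integrable.
  have hm : Measurable[m] (A.indicator ξ) := hξ.1.indicator hA
  have hle : ∀ ω ∈ A, payoff V Y X ξ ω ≤ payoff V Y X' (A.indicator ξ) ω := fun ω hω => by
    simp only [payoff, Set.indicator_of_mem hω]
    exact h.utility.mono ω (by linarith [show X ω ≤ X' ω from hω])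
  have hint : CondIntegrable P m (payoff V Y X' (A.indicator ξ)) := by
    refine h.condIntegrable_payoff hX' hm (b := fun ω => -(|payoff V Y X ξ ω| +
      |payoff V Y X' 0 ω|)) (hξ.2.abs.add (h.condIntegrable_eval hX').abs).neg
      (ae_of_all _ fun ω => ?_)
    by_cases hω : ω ∈ A
    · linarith [hle ω hω, neg_abs_le (payoff V Y X ξ ω), abs_nonneg (payoff V Y X' 0 ω)]
    · have : payoff V Y X' (A.indicator ξ) ω = payoff V Y X' 0 ω := by
        simp [payoff, hω]
      rw [this]
      linarith [neg_abs_le (payoff V Y X' 0 ω), abs_nonneg (payoff V Y X ξ ω)]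
  exact ⟨_, ⟨hm, hint⟩, ce_mono_on h.le hξ.2 hint hA (ae_of_all _ hle)⟩

theorem exists_position_of_convexCombination (h : OnePeriod P m Y L p q C V) {x y z : ℝ}
    (hxy : x < y) (hyz : y < z) {ξ ζ : Ω → EuclideanSpace ℝ (Fin d)}
    (hξ : ξ ∈ positions P m V Y fun _ => x) (hζ : ζ ∈ positions P m V Y fun _ => z) :
    ∃ η ∈ positions P m V Y fun _ => y, ∀ᵐ ω ∂P,
      (z - y) * ce P m (payoff V Y (fun _ => x) ξ) ω +
        (y - x) * ce P m (payoff V Y (fun _ => z) ζ) ω ≤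
      (z - x) * ce P m (payoff V Y (fun _ => y) η) ω := by
  let a : ℝ := (z - y) / (z - x)
  let b : ℝ := (y - x) / (z - x)
  have hzx : 0 < z - x := by linarith
  have ha : 0 ≤ a := div_nonneg (by linarith) hzx.le
  have hb : 0 ≤ b := div_nonneg (by linarith) hzx.le
  have hab : a + b = 1 := by simp only [a, b]; field_simp; ring
  have hy : y = a * x + b * z := by simp only [a, b]; field_simp; ring
  let η : Ω → EuclideanSpace ℝ (Fin d) := fun ω => a • ξ ω + b • ζ ω
  have hη : Measurable[m] η := (hξ.1.const_smul a).add (hζ.1.const_smul b)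
  have hle : ∀ ω, a * payoff V Y (fun _ => x) ξ ω + b * payoff V Y (fun _ => z) ζ ω ≤
      payoff V Y (fun _ => y) η ω := by
    intro ω
    have h1 := (h.utility.concave ω).2 (Set.mem_univ (x + inner ℝ (ξ ω) (Y ω)))
      (Set.mem_univ (z + inner ℝ (ζ ω) (Y ω))) ha hb hab
    have h2 : y + inner ℝ (η ω) (Y ω) =
        a • (x + inner ℝ (ξ ω) (Y ω)) + b • (z + inner ℝ (ζ ω) (Y ω)) := by
      simp only [η, inner_add_left, inner_smul_left, smul_eq_mul]
      rw [hy]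
      simp
      ring
    simp only [payoff, h2]
    exact h1
  have h1 := hξ.2.mul_left h.le (r := fun _ => a) measurable_const
  have h2 := hζ.2.mul_left h.le (r := fun _ => b) measurable_const
  have hint : CondIntegrable P m (payoff V Y (fun _ => y) η) :=
    h.condIntegrable_payoff measurable_const hη (h1.add h2) (ae_of_all _ hle)
  refine ⟨η, ⟨hη, hint⟩, ?_⟩
  filter_upwards [ce_mono (h1.add h2) hint (ae_of_all _ hle), ce_add h1 h2,
    ce_mul_left h.le (r := fun _ => a) measurable_const hξ.2,
    ce_mul_left h.le (r := fun _ => b) measurable_const hζ.2] with ω a1 a2 a3 a4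
  rw [a2, a3, a4] at a1
  have h3 := mul_le_mul_of_nonneg_left a1 hzx.le
  have e1 : (z - x) * a = z - y := mul_div_cancel₀ _ hzx.ne'
  have e2 : (z - x) * b = y - x := mul_div_cancel₀ _ hzx.ne'
  rw [mul_add, ← mul_assoc, ← mul_assoc, e1, e2] at h3
  exact h3

/-- Scaling down a position does not lower its conditional expected utility too much. -/
theorem exists_position_of_scaling (h : OnePeriod P m Y L p q C V) {e : ℝ}
    (hgr : ∀ᵐ ω ∂P, ∀ x l : ℝ, 1 ≤ l → V (l * x) ω ≤ l ^ e * (V x ω + C))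
    {x l : ℝ} (hl : 1 ≤ l) {ξ : Ω → EuclideanSpace ℝ (Fin d)}
    (hξ : ξ ∈ positions P m V Y fun _ => l * x) :
    ∃ η ∈ positions P m V Y fun _ => x, ∀ᵐ ω ∂P,
      ce P m (payoff V Y (fun _ => l * x) ξ) ω ≤
        l ^ e * (ce P m (payoff V Y (fun _ => x) η) ω + C) := by
  have hl0 : 0 < l := by linarith
  have hle0 : 0 < l ^ e := by positivity
  let η : Ω → EuclideanSpace ℝ (Fin d) := fun ω => l⁻¹ • ξ ω
  have hη : Measurable[m] η := hξ.1.const_smul (l⁻¹ : ℝ)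
  have hle : ∀ᵐ ω ∂P, (l ^ e)⁻¹ * payoff V Y (fun _ => l * x) ξ ω + -C ≤
      payoff V Y (fun _ => x) η ω := by
    filter_upwards [hgr] with ω hω
    have h1 := hω (x + inner ℝ (η ω) (Y ω)) l hl
    have h2 : l * (x + inner ℝ (η ω) (Y ω)) = l * x + inner ℝ (ξ ω) (Y ω) := by
      simp only [η, inner_smul_left]
      simp [mul_add, mul_inv_cancel_left₀ hl0.ne']
    rw [h2] at h1
    simp only [payoff]
    have h3 := (inv_mul_le_iff₀ hle0).2 h1
    linarith
  have h1 := hξ.2.mul_left h.le (r := fun _ => (l ^ e)⁻¹) measurable_const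
  have h2 := condIntegrable_of_measurable (P := P) h.le (f := fun _ => -C) measurable_const
  have hint : CondIntegrable P m (payoff V Y (fun _ => x) η) :=
    h.condIntegrable_payoff measurable_const hη (h1.add h2) hle
  refine ⟨η, ⟨hη, hint⟩, ?_⟩
  filter_upwards [ce_mono (h1.add h2) hint hle, ce_add h1 h2,
    ce_mul_left h.le (r := fun _ => (l ^ e)⁻¹) measurable_const hξ.2] with ω a1 a2 a3
  rw [a2, a3, ce_of_measurable h.le measurable_const] at a1
  rw [← inv_mul_le_iff₀ hle0]
  linarith

/-- `W` is a regular version of the value function of the one-period problem. -/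
structure IsValue (P : Measure[mΩ] Ω) (m : MeasurableSpace Ω)
    (Y : Ω → EuclideanSpace ℝ (Fin d)) (V W : ℝ → Ω → ℝ) : Prop where
  meas : ∀ x, Measurable[m] (W x)
  mono : ∀ ω, Monotone fun x => W x ω
  concave : ∀ ω, ConcaveOn ℝ Set.univ fun x => W x ω
  ce_le : ∀ X : Ω → ℝ, Measurable[m] X → ∀ ξ ∈ positions P m V Y X, ∀ᵐ ω ∂P,
    ce P m (payoff V Y X ξ) ω ≤ W (X ω) ω
  attained : ∀ X : Ω → ℝ, Measurable[m] X → ∃ ξ ∈ positions P m V Y X, ∀ᵐ ω ∂P,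
    ce P m (payoff V Y X ξ) ω = W (X ω) ω

theorem IsValue.continuous {W : ℝ → Ω → ℝ} (hW : IsValue P m Y V W) (ω : Ω) :
    Continuous fun x => W x ω :=
  continuous_of_concaveOn_univ (hW.concave ω)

theorem IsValue.measurable_eval {W : ℝ → Ω → ℝ} (hW : IsValue P m Y V W) {X : Ω → ℝ}
    (hX : Measurable[m] X) : Measurable[m] fun ω => W (X ω) ω :=
  UtilityMax.measurable_eval hW.meas hW.continuous hX

/-- Optimal values at constant wealth are monotone and concave almost surely and are regularized. A
random wealth `X` is compared with rational wealths above it for the upper bound and below it for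
attainment; continuity of the paths closes the gap. -/
theorem exists_isValue (h : OnePeriod P m Y L p q C V) : ∃ W, IsValue P m Y V W := by
  choose ξ hξ hopt using fun x : ℝ => h.exists_optimal_position (X := fun _ => x) measurable_const
  let w : ℝ → Ω → ℝ := fun x => ce P m (payoff V Y (fun _ => x) (ξ x))
  have hle : ∀ (X : Ω → ℝ), Measurable[m] X → ∀ ζ ∈ positions P m V Y X, ∀ y : ℝ, ∀ᵐ ω ∂P,
      X ω ≤ y → ce P m (payoff V Y X ζ) ω ≤ w y ω := by
    intro X hX ζ hζ y
    obtain ⟨ζ', hζ', hle⟩ := h.exists_position_of_le hX (X' := fun _ => y) measurable_const hζ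
    filter_upwards [hle, hopt y ζ' hζ'] with ω h1 h2 h3 using (h1 h3).trans h2
  obtain ⟨W, hWm, hWmono, hWconc, hWw⟩ := exists_regular_version (P := P) h.complete (w := w)
    (fun x => measurable_ce _ _ _) (fun x y hxy => by
      filter_upwards [hle (fun _ => x) measurable_const (ξ x) (hξ x) y] with ω hω using hω hxy)
    (fun x y z hxy hyz => by
      obtain ⟨η, hη, hη'⟩ := h.exists_position_of_convexCombination hxy hyz (hξ x) (hξ z)
      filter_upwards [hη', hopt y η hη] with ω h1 h2
      exact h1.trans (mul_le_mul_of_nonneg_left h2 (by linarith)))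
  have hcont : ∀ ω, Continuous fun x => W x ω := fun ω =>
    continuous_of_concaveOn_univ (hWconc ω)
  have hce_le : ∀ X : Ω → ℝ, Measurable[m] X → ∀ ξ ∈ positions P m V Y X, ∀ᵐ ω ∂P,
      ce P m (payoff V Y X ξ) ω ≤ W (X ω) ω := by
    intro X hX ζ hζ
    filter_upwards [ae_all_iff.2 fun r : ℚ => hle X hX ζ hζ r, ae_all_iff.2 fun r : ℚ => hWw r]
      with ω h1 h2
    obtain ⟨u, hu, hux⟩ := exists_rat_seq_right (X ω)
    refine ge_of_tendsto' (((hcont ω).tendsto _).comp hux) fun n => ?_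
    rw [Function.comp_apply, h2]
    exact h1 _ (hu n).le
  refine ⟨W, hWm, hWmono, hWconc, hce_le, fun X hX => ?_⟩
  obtain ⟨ζ, hζ, hζopt⟩ := h.exists_optimal_position hX
  refine ⟨ζ, hζ, ?_⟩
  have hge : ∀ᵐ ω ∂P, ∀ r : ℚ, (r : ℝ) ≤ X ω → w r ω ≤ ce P m (payoff V Y X ζ) ω := by
    refine ae_all_iff.2 fun r => ?_
    obtain ⟨ζ', hζ', hle'⟩ := h.exists_position_of_le (X := fun _ => (r : ℝ)) measurable_const hX
      (hξ r)
    filter_upwards [hle', hζopt ζ' hζ'] with ω h1 h2 h3 using (h1 h3).trans h2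
  filter_upwards [hce_le X hX ζ hζ, hge, ae_all_iff.2 fun r : ℚ => hWw r] with ω h1 h2 h3
  refine le_antisymm h1 ?_
  obtain ⟨u, hu, hux⟩ := exists_rat_seq_left (X ω)
  refine le_of_tendsto' (((hcont ω).tendsto _).comp hux) fun n => ?_
  rw [Function.comp_apply, h3]
  exact h2 _ (hu n).le

theorem IsValue.lower {W : ℝ → Ω → ℝ} (hW : IsValue P m Y V W)
    (h : OnePeriod P m Y L p q C V) : ∀ᵐ ω ∂P, ∀ x, L x ≤ W x ω := by
  have h1 : ∀ x : ℝ, ∀ᵐ ω ∂P, L x ≤ W x ω := by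
    intro x
    have hc := condIntegrable_of_measurable (P := P) h.le (f := fun _ => L x) measurable_const
    filter_upwards [hW.ce_le (fun _ => x) measurable_const 0
      (h.zero_mem_positions measurable_const), ce_mono hc (h.condIntegrable_eval
        (X := fun _ => x) measurable_const) (by
        filter_upwards [h.utility.lower] with ω hω
        simpa [payoff] using hω x)] with ω h1 h2
    rw [ce_of_measurable h.le measurable_const] at h2
    exact h2.trans h1
  filter_upwards [ae_all_iff.2 fun r : ℚ => h1 r] with ω hω x
  exact le_of_forall_rat_le h.continuous_L (hW.continuous ω) hω x

/-- An optimal position from wealth `l x`, divided by `l`, is a competitor from wealth `x`. Rational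
parameters are treated first so that only countably many null sets occur. -/
theorem IsValue.growth {W : ℝ → Ω → ℝ} (hW : IsValue P m Y V W)
    (h : OnePeriod P m Y L p q C V) {e : ℝ}
    (hgr : ∀ᵐ ω ∂P, ∀ x l : ℝ, 1 ≤ l → V (l * x) ω ≤ l ^ e * (V x ω + C)) :
    ∀ᵐ ω ∂P, ∀ x l : ℝ, 1 ≤ l → W (l * x) ω ≤ l ^ e * (W x ω + C) := by
  have h1 : ∀ᵐ ω ∂P, ∀ x l : ℚ, 1 ≤ l → W (l * x) ω ≤ (l : ℝ) ^ e * (W x ω + C) := by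
    refine ae_all_iff.2 fun x => ae_all_iff.2 fun l => ?_
    by_cases hl : 1 ≤ l
    · have hl' : (1 : ℝ) ≤ l := by exact_mod_cast hl
      obtain ⟨ξ, hξ, hξW⟩ := hW.attained (fun _ => (l : ℝ) * x) measurable_const
      obtain ⟨η, hη, hle⟩ := h.exists_position_of_scaling hgr hl' hξ
      filter_upwards [hξW, hle, hW.ce_le _ measurable_const η hη] with ω a1 a2 a3 _
      rw [← a1]
      refine a2.trans (mul_le_mul_of_nonneg_left (by linarith) (by positivity))
    · exact ae_of_all _ fun ω h => absurd h hl
  filter_upwards [h1] with ω hω x l hl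
  exact growth_of_forall_rat (hW.continuous ω) hω x l hl

/-- If the value stayed above `-M` along all wealths `-n`, the corresponding optimal positions
together with these wealths would be bounded by `ae_bounded`, which the wealths are not. -/
theorem IsValue.unbounded {W : ℝ → Ω → ℝ} (hW : IsValue P m Y V W)
    (h : OnePeriod P m Y L p q C V) :
    ∀ᵐ ω ∂P, Tendsto (fun n : ℕ => W (-n) ω) atTop atBot := by
  have key : ∀ M : ℕ, ∀ᵐ ω ∂P, ¬ ∀ n : ℕ, -(M : ℝ) ≤ W (-n) ω := by
    intro M
    let A : Set Ω := ⋂ n : ℕ, {ω | -(M : ℝ) ≤ W (-n) ω}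
    have hA : MeasurableSet[m] A := MeasurableSet.iInter fun n =>
      measurableSet_le measurable_const (hW.meas _)
    -- Wealth goes to `-∞` only on the bad set; elsewhere it is zero, so `min (-M) (W 0)` is a lower
    -- bound for all `n` at once.
    let X : ℕ → Ω → ℝ := fun n => A.indicator fun _ => -(n : ℝ)
    have hX : ∀ n, Measurable[m] (X n) := fun n => measurable_const.indicator hA
    choose ξ hξ hξW using fun n => hW.attained (X n) (hX n)
    choose ξ' hξ' hce horth using fun n => h.exists_orthogonal_mem_positions (hX n) (hξ n)
    have hbdd := h.ae_bounded (X := X) (ξ := ξ') (M := fun ω => min (-(M : ℝ)) (W 0 ω))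
      (b := fun _ => 0) (Measurable.min measurable_const (hW.meas 0)) hX (fun n => (hξ' n).1)
      (fun n ω => by
        by_cases hω : ω ∈ A <;> simp [X, hω])
      (fun n => (hξ' n).2) (fun n => by
        filter_upwards [hce n, hξW n] with ω h1 h2
        rw [h1, h2]
        by_cases hω : ω ∈ A
        · simp only [X, Set.indicator_of_mem hω]
          exact (min_le_left _ _).trans (Set.mem_iInter.1 hω n)
        · simp [X, hω]) horth
    filter_upwards [hbdd] with ω ⟨K, hK⟩ hω
    have hωA : ω ∈ A := Set.mem_iInter.2 hω
    have := (hK (K + 1)).1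
    simp only [X, Set.indicator_of_mem hωA, abs_neg, Nat.abs_cast] at this
    push_cast at this
    linarith
  filter_upwards [ae_all_iff.2 key] with ω hω
  refine tendsto_atBot.2 fun a => ?_
  obtain ⟨M, hM⟩ := exists_nat_gt (-a)
  have h1 := hω M
  push Not at h1
  obtain ⟨n, hn⟩ := h1
  filter_upwards [eventually_ge_atTop n] with k hk
  have : W (-k) ω ≤ W (-n) ω := hW.mono ω (neg_le_neg (by exact_mod_cast hk))
  linarith

theorem IsValue.randomUtility {W : ℝ → Ω → ℝ} (hW : IsValue P m Y V W)
    (h : OnePeriod P m Y L p q C V) : RandomUtility P m L p q C W where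
  meas := hW.meas
  mono := hW.mono
  concave := hW.concave
  lower := hW.lower h
  growth := by
    filter_upwards [hW.growth h (e := p) (h.utility.growth.mono fun ω hω x l hl => (hω x l hl).1),
      hW.growth h (e := q) (h.utility.growth.mono fun ω hω x l hl => (hω x l hl).2)]
      with ω h1 h2 x l hl using ⟨h1 x l hl, h2 x l hl⟩
  unbounded := hW.unbounded h

end OnePeriod

end ValueFunction
-- From conditional to unconditional integrability
section Integrability

open Filter Topology
open scoped ENNReal

variable {Ω : Type*} {m mΩ : MeasurableSpace Ω} {P : Measure Ω} [IsProbabilityMeasure P] {d : ℕ}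

theorem integrable_of_lintegral_ne_top {f : Ω → ℝ} (hf : Measurable f)
    (h1 : ∫⁻ ω, ENNReal.ofReal (f ω) ∂P ≠ ⊤) (h2 : ∫⁻ ω, ENNReal.ofReal (-f ω) ∂P ≠ ⊤) :
    Integrable f P := by
  have h3 : Integrable (fun ω => (ENNReal.ofReal (f ω)).toReal) P :=
    integrable_toReal_of_lintegral_ne_top hf.ennreal_ofReal.aemeasurable h1
  have h4 : Integrable (fun ω => (ENNReal.ofReal (-f ω)).toReal) P :=
    integrable_toReal_of_lintegral_ne_top hf.neg.ennreal_ofReal.aemeasurable h2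
  refine (h3.sub h4).congr (ae_of_all _ fun ω => ?_)
  simp only [Pi.sub_apply, ENNReal.toReal_ofReal', max_zero_sub_max_neg_zero_eq_self]

theorem lintegral_ofReal_ne_top_of_integrable {f : Ω → ℝ} (hf : Integrable f P) :
    ∫⁻ ω, ENNReal.ofReal (f ω) ∂P ≠ ⊤ :=
  ne_top_of_le_ne_top hf.2.ne (lintegral_mono fun _ => Real.ofReal_le_enorm _)

theorem integrable_ce (hm : m ≤ mΩ) {f : Ω → ℝ} (hf : Integrable f P) :
    Integrable (ce P m f) P ∧ ∫ ω, ce P m f ω ∂P = ∫ ω, f ω ∂P := by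
  have h1 : ∀ g : Ω → ℝ, Integrable g P →
      Integrable (fun ω => (condLExp m P (fun ω => ENNReal.ofReal (g ω)) ω).toReal) P ∧
      ∫ ω, (condLExp m P (fun ω => ENNReal.ofReal (g ω)) ω).toReal ∂P =
        (∫⁻ ω, ENNReal.ofReal (g ω) ∂P).toReal := by
    intro g hg
    have h2 := lintegral_ofReal_ne_top_of_integrable hg
    rw [← lintegral_condLExp hm] at h2 ⊢
    have h3 := (measurable_condLExp' m P fun ω => ENNReal.ofReal (g ω)).aemeasurable (μ := P)
    exact ⟨integrable_toReal_of_lintegral_ne_top h3 h2, integral_toReal h3 (ae_lt_top' h3 h2)⟩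
  obtain ⟨h2, h3⟩ := h1 f hf
  obtain ⟨h4, h5⟩ := h1 _ hf.neg
  refine ⟨h2.sub h4, ?_⟩
  rw [integral_eq_lintegral_pos_part_sub_lintegral_neg_part hf]
  refine (integral_sub h2 h4).trans ?_
  rw [h3, h5]
  rfl

/-- A conditionally integrable variable is integrable if its conditional expectation is
bounded above and its negative part is integrable. -/
theorem CondIntegrable.integrable_of_le (hm : m ≤ mΩ) {f G : Ω → ℝ} (hf : CondIntegrable P m f)
    (hG : Integrable G P) (hle : ∀ᵐ ω ∂P, ce P m f ω ≤ G ω)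
    (hneg : ∫⁻ ω, ENNReal.ofReal (-f ω) ∂P ≠ ⊤) : Integrable f P := by
  refine integrable_of_lintegral_ne_top hf.meas ?_ hneg
  rw [← lintegral_condLExp hm] at hneg ⊢
  have h1 := lintegral_ofReal_ne_top_of_integrable hG
  -- The conditional expectation of `f⁺` is at most `G⁺` plus that of `f⁻`, and both have finite
  -- integrals.
  refine ne_top_of_le_ne_top (b := ∫⁻ ω, (ENNReal.ofReal (G ω) +
    condLExp m P (fun ω => ENNReal.ofReal (-f ω)) ω) ∂P) ?_ ?_
  · rw [lintegral_add_right _ (measurable_condLExp' _ _ _)]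
    exact ENNReal.add_ne_top.2 ⟨h1, hneg⟩
  · refine lintegral_mono_ae ?_
    filter_upwards [hle, hf.pos_lt_top, hf.neg_lt_top] with ω a1 a2 a3
    rw [← ENNReal.ofReal_toReal a2.ne, ← ENNReal.ofReal_toReal a3.ne]
    refine (ENNReal.ofReal_le_ofReal ?_).trans ENNReal.ofReal_add_le
    simp only [ce] at a1
    linarith

namespace OnePeriod

variable {Y : Ω → EuclideanSpace ℝ (Fin d)} {L : ℝ → ℝ} {p q C : ℝ} {V W : ℝ → Ω → ℝ}

theorem condLExp_payoff_lt_top (h : OnePeriod P m Y L p q C V) {X : Ω → ℝ}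
    {ξ : Ω → EuclideanSpace ℝ (Fin d)} (hX : Measurable[m] X) (hξ : Measurable[m] ξ) :
    ∀ᵐ ω ∂P, condLExp m P (fun ω => ENNReal.ofReal (payoff V Y X ξ ω)) ω < ⊤ := by
  have h1 := (h.condIntegrable_dominant.mul_left h.le (r := fun ω => (1 + |X ω| + ‖ξ ω‖) ^ p)
    (by fun_prop)).pos_lt_top
  filter_upwards [h1, condLExp_mono (P := P) (mΩ := m)
    (X := fun ω => ENNReal.ofReal (payoff V Y X ξ ω))
    (Y := fun ω => ENNReal.ofReal ((1 + |X ω| + ‖ξ ω‖) ^ p * dominant V Y C ω)) (by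
      filter_upwards [h.payoff_le_dominant] with ω hω
      refine ENNReal.ofReal_le_ofReal (hω _ _ _ ?_ ?_ ?_)
      · linarith [abs_nonneg (X ω), norm_nonneg (ξ ω)]
      · linarith [le_abs_self (X ω), norm_nonneg (ξ ω)]
      · linarith [abs_nonneg (X ω)])] with ω h1 h2
  exact h2.trans_lt h1

/-- The generalized conditional expected utility of any position is dominated by the value. -/
theorem genCondExp_payoff_le (h : OnePeriod P m Y L p q C V) (hW : IsValue P m Y V W)
    {X : Ω → ℝ} {ξ : Ω → EuclideanSpace ℝ (Fin d)} (hX : Measurable[m] X)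
    (hξ : Measurable[m] ξ) :
    ∀ᵐ ω ∂P, genCondExp P m (payoff V Y X ξ) ω ≤ ((W (X ω) ω : ℝ) : EReal) := by
  -- On `A` the position is a genuine competitor once it is set to zero outside; off `A` the
  -- positive part is finite, so the generalized conditional expectation is `-∞`.
  let A : Set Ω := {ω | condLExp m P (fun ω => ENNReal.ofReal (-payoff V Y X ξ ω)) ω < ⊤}
  have hA : MeasurableSet[m] A := measurableSet_lt (measurable_condLExp _ _ _) measurable_const
  have hζ : Measurable[m] (A.indicator ξ) := hξ.indicator hA
  have hm1 := h.measurable_payoff (hX.mono h.le le_rfl) (hξ.mono h.le le_rfl)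
  have hm2 := h.measurable_payoff (hX.mono h.le le_rfl) (hζ.mono h.le le_rfl)
  have hm3 := (h.condIntegrable_eval hX).meas
  have e1 : ∀ ω ∈ A, payoff V Y X (A.indicator ξ) ω = payoff V Y X ξ ω := fun ω hω => by
    simp only [payoff, Set.indicator_of_mem hω]
  have e2 : ∀ ω ∈ Aᶜ, payoff V Y X (A.indicator ξ) ω = payoff V Y X 0 ω := fun ω hω => by
    simp [payoff, Set.indicator_of_notMem hω]
  have hneg := condLExp_congr_on (P := P) h.le hm2.neg.ennreal_ofReal hm1.neg.ennreal_ofReal hA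
    (ae_of_all _ fun ω hω => by simp only [Pi.neg_apply, e1 ω hω])
  have hpos := condLExp_congr_on (P := P) h.le hm2.ennreal_ofReal hm1.ennreal_ofReal hA
    (ae_of_all _ fun ω hω => by rw [e1 ω hω])
  have hnegc := condLExp_congr_on (P := P) h.le hm2.neg.ennreal_ofReal hm3.neg.ennreal_ofReal
    hA.compl (ae_of_all _ fun ω hω => by simp only [Pi.neg_apply, e2 ω hω])
  have hint : CondIntegrable P m (payoff V Y X (A.indicator ξ)) := by
    refine condIntegrable_of_pos_neg hm2 (h.condLExp_payoff_lt_top hX hζ) ?_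
    filter_upwards [hneg, hnegc, (h.condIntegrable_eval hX).neg_lt_top] with ω a1 a2 a3
    by_cases hω : ω ∈ A
    · exact (a1 hω).trans_lt hω
    · exact (a2 hω).trans_lt a3
  filter_upwards [hneg, hpos, hW.ce_le X hX _ ⟨hζ, hint⟩, genCondExp_eq_ce hint,
    h.condLExp_payoff_lt_top hX hξ] with ω a1 a2 a3 a4 a5
  by_cases hω : ω ∈ A
  · have : genCondExp P m (payoff V Y X ξ) ω =
        genCondExp P m (payoff V Y X (A.indicator ξ)) ω := by
      have b1 := a1 hω
      have b2 := a2 hω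
      simp only [Pi.neg_apply] at b1
      simp only [genCondExp, b1, b2]
    rw [this, a4]
    exact_mod_cast a3
  · have h1 : condLExp m P (fun ω => ENNReal.ofReal (-payoff V Y X ξ ω)) ω = ⊤ := by
      simpa [A] using hω
    rw [genCondExp, h1]
    lift condLExp m P (fun ω => ENNReal.ofReal (payoff V Y X ξ ω)) ω to NNReal using a5.ne with c hc
    simp

/-- If the negative part of the payoff is integrable, so is the negative part of the value. -/
theorem lintegral_neg_value_ne_top (h : OnePeriod P m Y L p q C V) (hW : IsValue P m Y V W)
    {X : Ω → ℝ} {ξ : Ω → EuclideanSpace ℝ (Fin d)} (hX : Measurable[m] X) (hξ : Measurable[m] ξ)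
    (hneg : ∫⁻ ω, ENNReal.ofReal (-payoff V Y X ξ ω) ∂P ≠ ⊤) :
    ξ ∈ positions P m V Y X ∧ ∫⁻ ω, ENNReal.ofReal (-W (X ω) ω) ∂P ≠ ⊤ := by
  have hm1 := h.measurable_payoff (hX.mono h.le le_rfl) (hξ.mono h.le le_rfl)
  have hint : CondIntegrable P m (payoff V Y X ξ) :=
    condIntegrable_of_pos_neg hm1 (h.condLExp_payoff_lt_top hX hξ) (condLExp_lt_top hneg)
  refine ⟨⟨hξ, hint⟩, ?_⟩
  rw [← lintegral_condLExp h.le] at hneg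
  refine ne_top_of_le_ne_top hneg (lintegral_mono_ae ?_)
  filter_upwards [hW.ce_le X hX ξ ⟨hξ, hint⟩, hint.neg_lt_top] with ω a1 a2
  rw [← ENNReal.ofReal_toReal a2.ne]
  refine ENNReal.ofReal_le_ofReal ?_
  have : 0 ≤ (condLExp m P (fun ω => ENNReal.ofReal (payoff V Y X ξ ω)) ω).toReal :=
    ENNReal.toReal_nonneg
  simp only [ce] at a1
  linarith

/-- A payoff whose negative part is integrable has expectation at most that of the value. -/
theorem integrable_payoff_of_value (h : OnePeriod P m Y L p q C V) (hW : IsValue P m Y V W)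
    {X : Ω → ℝ} {ξ : Ω → EuclideanSpace ℝ (Fin d)} (hX : Measurable[m] X) (hξ : Measurable[m] ξ)
    (hneg : ∫⁻ ω, ENNReal.ofReal (-payoff V Y X ξ ω) ∂P ≠ ⊤)
    (hWX : Integrable (fun ω => W (X ω) ω) P) :
    Integrable (payoff V Y X ξ) P ∧ ∫ ω, payoff V Y X ξ ω ∂P ≤ ∫ ω, W (X ω) ω ∂P := by
  obtain ⟨hpos, -⟩ := h.lintegral_neg_value_ne_top hW hX hξ hneg
  have hle := hW.ce_le X hX ξ hpos
  have hi := hpos.2.integrable_of_le h.le hWX hle hneg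
  obtain ⟨h1, h2⟩ := integrable_ce h.le hi
  exact ⟨hi, h2 ▸ integral_mono_ae h1 hWX hle⟩

/-- Not trading from wealth zero is bounded below by `L 0` and above by the value. This propagates
the integrability at zero needed for optimal payoffs at the next date. -/
theorem integrable_zero (h : OnePeriod P m Y L p q C V) (hW : IsValue P m Y V W)
    (hW0 : Integrable (W 0) P) : Integrable (V 0) P := by
  have h1 := (h.integrable_payoff_of_value hW (X := fun _ => 0) (ξ := 0) measurable_const
    measurable_const (ne_top_of_le_ne_top (b := ∫⁻ ω, ENNReal.ofReal (-L 0) ∂P) (by simp)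
      (lintegral_mono_ae (by
        filter_upwards [h.utility.lower] with ω hω
        refine ENNReal.ofReal_le_ofReal ?_
        simpa [payoff] using hω 0))) hW0).1
  refine h1.congr (ae_of_all _ fun ω => ?_)
  simp [payoff]

/-- The payoff of an optimal position inherits integrability from the value. -/
theorem integrable_payoff_of_optimal (h : OnePeriod P m Y L p q C V) (hW : IsValue P m Y V W)
    {X : Ω → ℝ} {ξ : Ω → EuclideanSpace ℝ (Fin d)} (hX : Measurable[m] X)
    (hξ : ξ ∈ positions P m V Y X) (hopt : ∀ᵐ ω ∂P, ce P m (payoff V Y X ξ) ω = W (X ω) ω)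
    (hWX : Integrable (fun ω => W (X ω) ω) P) (hW0 : Integrable (W 0) P) :
    Integrable (payoff V Y X ξ) P ∧ ∫ ω, payoff V Y X ξ ω ∂P = ∫ ω, W (X ω) ω ∂P := by
  let f := payoff V Y X ξ
  have hf : CondIntegrable P m f := hξ.2
  -- The halved wealth and position form a competitor whose payoff is compared with `f` through the
  -- growth bounds at `l = 2`.
  let X' : Ω → ℝ := fun ω => (1 / 2) * X ω
  let ζ : Ω → EuclideanSpace ℝ (Fin d) := fun ω => (1 / 2 : ℝ) • ξ ω
  have hX' : Measurable[m] X' := hX.const_mul _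
  have hζ : Measurable[m] ζ := hξ.1.const_smul (1 / 2 : ℝ)
  let a : ℝ := (2 ^ p)⁻¹
  let b : ℝ := (2 ^ q)⁻¹
  have hba : b < a := inv_strictAnti₀ (by positivity)
    (Real.rpow_lt_rpow_of_exponent_lt one_lt_two h.p_lt_q)
  have hb0 : 0 < b := by positivity
  -- Exponent `p` is used where `f ≥ 0` and exponent `q` where `f ≤ 0`; since `b < a`, a positive
  -- multiple of `f⁺` is left over.
  have hle : ∀ᵐ ω ∂P, (a - b) * max (f ω) 0 + (b * f ω + -C) ≤ payoff V Y X' ζ ω := by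
    filter_upwards [h.utility.growth] with ω hω
    have e : 2 * (X' ω + inner ℝ (ζ ω) (Y ω)) = X ω + inner ℝ (ξ ω) (Y ω) := by
      simp only [X', ζ, inner_smul_left]
      simp
      ring
    obtain ⟨h1, h2⟩ := hω (X' ω + inner ℝ (ζ ω) (Y ω)) 2 one_le_two
    rw [e, ← inv_mul_le_iff₀ (by positivity)] at h1 h2
    change a * f ω ≤ payoff V Y X' ζ ω + C at h1
    change b * f ω ≤ payoff V Y X' ζ ω + C at h2
    rcases le_total 0 (f ω) with h3 | h3
    · rw [max_eq_left h3]
      linarith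
    · rw [max_eq_right h3]
      linarith
  have hfp : CondIntegrable P m fun ω => max (f ω) 0 :=
    hf.mono (hf.meas.max measurable_const) (ae_of_all _ fun ω => by
      rw [abs_of_nonneg (le_max_right _ _)]
      exact max_le (le_abs_self _) (abs_nonneg _))
  have i1 := hfp.mul_left h.le (r := fun _ => a - b) measurable_const
  have i2 := hf.mul_left h.le (r := fun _ => b) measurable_const
  have i3 := condIntegrable_of_measurable (P := P) h.le (f := fun _ => -C) measurable_const
  have hint : CondIntegrable P m (payoff V Y X' ζ) :=
    h.condIntegrable_payoff hX' hζ (i1.add (i2.add i3)) hle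
  let G : Ω → ℝ := fun ω => (a - b)⁻¹ * (|W (X ω) ω| + |W 0 ω| + b * |W (X ω) ω| + C)
  have hG : Integrable G P :=
    (((hWX.abs.add hW0.abs).add (hWX.abs.const_mul b)).add (integrable_const C)).const_mul _
  have hceG : ∀ᵐ ω ∂P, ce P m (fun ω => max (f ω) 0) ω ≤ G ω := by
    filter_upwards [ce_mono (i1.add (i2.add i3)) hint hle, ce_add i1 (i2.add i3), ce_add i2 i3,
      ce_mul_left h.le (r := fun _ => a - b) measurable_const hfp,
      ce_mul_left h.le (r := fun _ => b) measurable_const hf,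
      hW.ce_le X' hX' ζ ⟨hζ, hint⟩, hopt] with ω a1 a2 a3 a4 a5 a6 a7
    rw [a2, a3, a4, a5, ce_of_measurable h.le measurable_const] at a1
    have a7' : ce P m f ω = W (X ω) ω := a7
    rw [a7'] at a1
    -- By monotonicity, half the wealth is worth at most the larger of `W` at `X` and at zero; this
    -- is where integrability of `W 0` enters.
    have h1 : W (X' ω) ω ≤ |W (X ω) ω| + |W 0 ω| := by
      rcases le_total 0 (X ω) with h2 | h2
      · have := hW.mono ω (show X' ω ≤ X ω by simp only [X']; linarith)
        dsimp only at this
        linarith [le_abs_self (W (X ω) ω), abs_nonneg (W 0 ω)]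
      · have := hW.mono ω (show X' ω ≤ 0 by simp only [X']; linarith)
        dsimp only at this
        linarith [le_abs_self (W 0 ω), abs_nonneg (W (X ω) ω)]
    rw [le_inv_mul_iff₀ (sub_pos.2 hba)]
    have h2 := mul_le_mul_of_nonneg_left (neg_abs_le (W (X ω) ω)) hb0.le
    linarith
  have hfpi : Integrable (fun ω => max (f ω) 0) P :=
    hfp.integrable_of_le h.le hG hceG (by
      have : ∀ ω, ENNReal.ofReal (-max (f ω) 0) = 0 := fun ω =>
        ENNReal.ofReal_of_nonpos (neg_nonpos.2 (le_max_right _ _))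
      simp only [this, lintegral_zero]
      simp)
  have hfi : Integrable f P := by
    have hneg : Integrable (fun ω => -f ω) P := by
      refine hf.neg.integrable_of_le h.le (G := fun ω => -W (X ω) ω) hWX.neg ?_ ?_
      · filter_upwards [hopt] with ω hω
        rw [ce_neg]
        exact (neg_le_neg hω.ge)
      · refine ne_top_of_le_ne_top (lintegral_ofReal_ne_top_of_integrable hfpi)
          (lintegral_mono fun ω => ENNReal.ofReal_le_ofReal ?_)
        rw [neg_neg]
        exact le_max_left _ _
    simpa using hneg.neg
  refine ⟨hfi, ?_⟩
  rw [← (integrable_ce h.le hfi).2]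
  exact integral_congr_ae hopt

end OnePeriod

end Integrability
-- From elasticity of the utility to the two growth exponents
section Growth

open Filter Topology

variable {U : ℝ → ℝ}

theorem tendsto_atBot_of_concaveOn (hc : ConcaveOn ℝ Set.univ U) (hm : Monotone U)
    (hne : ∃ x, U x ≠ U 0) : Tendsto U atBot atBot := by
  obtain ⟨a, b, hab, hU⟩ : ∃ a b, a < b ∧ U a < U b := by
    obtain ⟨x, hx⟩ := hne
    rcases le_total x 0 with h | h
    · exact ⟨x, 0, lt_of_le_of_ne h fun h => hx (by rw [h]), lt_of_le_of_ne (hm h) hx⟩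
    · exact ⟨0, x, lt_of_le_of_ne h fun h => hx (by rw [← h]), lt_of_le_of_ne (hm h) hx.symm⟩
  let s : ℝ := (U b - U a) / (b - a)
  have hs : 0 < s := div_pos (by linarith) (by linarith)
  have h1 : ∀ᶠ y in atBot, U y ≤ U a + s * (y - a) := by
    filter_upwards [eventually_lt_atBot a] with y hy
    have h2 := hc.slope_anti_adjacent (Set.mem_univ y) (Set.mem_univ b) hy hab
    have h3 : s ≤ (U a - U y) / (a - y) := h2
    rw [le_div_iff₀ (by linarith)] at h3
    linarith
  refine tendsto_atBot_mono' _ h1 (tendsto_atBot_add_const_left _ _ ?_)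
  exact (tendsto_atBot_add_const_right _ (-a) tendsto_id).const_mul_atBot hs

/-- The point `x - b` is the convex combination of `t x - b` and `-b` with weights `1/t` and `1 -
1/t`; concavity gives exponent `1` without any elasticity. -/
theorem growth_linear (hc : ConcaveOn ℝ Set.univ U) (hm : Monotone U) {l b C : ℝ} (hb : |b| ≤ l)
    (hC : -U (-l) ≤ C) (hC0 : 0 ≤ C) (x t : ℝ) (ht : 1 ≤ t) :
    U (t * x - b) ≤ t * (U (x - b) + C) := by
  have ht0 : 0 < t := by linarith
  have h1 := hc.2 (Set.mem_univ (t * x - b)) (Set.mem_univ (-b)) (inv_nonneg.2 ht0.le)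
    (sub_nonneg.2 (inv_le_one_of_one_le₀ ht)) (by ring)
  have h2 : t⁻¹ • (t * x - b) + (1 - t⁻¹) • (-b) = x - b := by
    simp only [smul_eq_mul]
    field_simp
    ring
  rw [h2, smul_eq_mul, smul_eq_mul] at h1
  have h3 : U (-l) ≤ U (-b) := hm (by linarith [(abs_le.1 hb).2])
  have h4 := mul_le_mul_of_nonneg_left h1 ht0.le
  have h5 : t * (t⁻¹ * U (t * x - b) + (1 - t⁻¹) * U (-b)) =
      U (t * x - b) + (t - 1) * U (-b) := by
    field_simp
  rw [h5] at h4
  have h6 := mul_le_mul_of_nonneg_left (show -C ≤ U (-b) by linarith) (sub_nonneg.2 ht)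
  linarith

theorem subadditive_of_concaveOn (hc : ConcaveOn ℝ Set.univ U) (h0 : U 0 = 0) {s t : ℝ}
    (hs : 0 < s) (ht : 0 < t) : U (s + t) ≤ U s + U t := by
  have key : ∀ {s t : ℝ}, 0 < s → 0 < t → s / (s + t) * U (s + t) ≤ U s := by
    intro s t hs ht
    have h1 := hc.2 (Set.mem_univ (s + t)) (Set.mem_univ 0) (show 0 ≤ s / (s + t) by positivity)
      (show 0 ≤ t / (s + t) by positivity) (by field_simp)
    have h2 : (s / (s + t)) • (s + t) + (t / (s + t)) • (0 : ℝ) = s := by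
      simp only [smul_eq_mul]
      field_simp
      ring
    rw [h2, h0] at h1
    simpa using h1
  have h1 := key hs ht
  have h2 := key ht hs
  rw [add_comm t s] at h2
  have h3 : U (s + t) = s / (s + t) * U (s + t) + t / (s + t) * U (s + t) := by
    field_simp
  linarith

/-- The exponents are `γ` and `1`. Where `U(x - b) + K` is nonpositive, the linear bound already
implies the one with the smaller exponent. -/
theorem ElasticAtTop.exists_growth (hU : ElasticAtTop U) {l : ℝ} (hl : 0 ≤ l) :
    ∃ p q C : ℝ, 0 < p ∧ p < q ∧ 0 ≤ C ∧ ∀ b, |b| ≤ l → ∀ x t : ℝ, 1 ≤ t →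
      U (t * x - b) ≤ t ^ p * (U (x - b) + C) ∧ U (t * x - b) ≤ t ^ q * (U (x - b) + C) := by
  obtain ⟨x₀, hx₀, γ, hγ0, hγ1, hg⟩ := hU.growth
  let K : ℝ := -U (-l)
  have hK : 0 ≤ K := by
    have := hU.mono (show -l ≤ 0 by linarith)
    rw [hU.zero] at this
    simp only [K]
    linarith
  have hK' : 0 ≤ U (2 * l + x₀) := by
    rw [← hU.zero]
    exact hU.mono (by positivity)
  refine ⟨γ, 1, K + U (2 * l + x₀), hγ0, hγ1, by positivity, fun b hb x t ht => ⟨?_, ?_⟩⟩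
  · have ht0 : 0 < t := by linarith
    have htγ : 0 < t ^ γ := by positivity
    rcases le_total (U (x - b) + K) 0 with h | h
    · refine (growth_linear hU.concave hU.mono hb le_rfl hK x t ht).trans ?_
      have h1 : t ^ γ ≤ t := by
        simpa using Real.rpow_le_rpow_of_exponent_le ht hγ1.le
      have h2 := mul_le_mul_of_nonpos_right h1 h
      have h3 := mul_nonneg htγ.le hK'
      change t * (U (x - b) + K) ≤ _
      linarith
    · obtain ⟨hb1, hb2⟩ := abs_le.1 hb
      -- Large enough for the elasticity condition and for `t x - b ≤ t y`, yet within a bounded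
      -- shift of `x - b` when `x > l`; subadditivity absorbs that shift into the constant.
      let y : ℝ := max x l + l + x₀
      have hy : x₀ ≤ y := by
        have := le_max_right x l
        simp only [y]
        linarith
      have h1 : t * x - b ≤ t * y := by
        have h2 : t * x ≤ t * max x l := mul_le_mul_of_nonneg_left (le_max_left _ _) ht0.le
        have h3 : 1 * l ≤ t * l := mul_le_mul_of_nonneg_right ht hl
        have h4 : 0 ≤ t * x₀ := by positivity
        simp only [y]
        linarith
      refine (hU.mono h1).trans ((hg y hy t ht).trans (mul_le_mul_of_nonneg_left ?_ htγ.le))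
      rcases le_or_gt x l with hxl | hxl
      · have : y = 2 * l + x₀ := by
          simp only [y, max_eq_right hxl]
          ring
        rw [this]
        linarith
      · have h2 : y = (x - b) + (l + b + x₀) := by
          simp only [y, max_eq_left hxl.le]
          ring
        rw [h2]
        refine (subadditive_of_concaveOn hU.concave hU.zero (by linarith) (by linarith)).trans ?_
        have := hU.mono (show l + b + x₀ ≤ 2 * l + x₀ by linarith)
        linarith
  · rw [Real.rpow_one]
    exact growth_linear hU.concave hU.mono hb (by change K ≤ _; linarith) (by positivity) x t ht

/-- The exponents are `1` and `1 + α/2`: half of `α` is given up to absorb the shift by `b`. -/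
theorem ElasticAtBot.exists_growth (hU : ElasticAtBot U) {l : ℝ} (hl : 0 ≤ l) :
    ∃ p q C : ℝ, 0 < p ∧ p < q ∧ 0 ≤ C ∧ ∀ b, |b| ≤ l → ∀ x t : ℝ, 1 ≤ t →
      U (t * x - b) ≤ t ^ p * (U (x - b) + C) ∧ U (t * x - b) ≤ t ^ q * (U (x - b) + C) := by
  obtain ⟨α, hα, x₀, hx₀, hg⟩ := hU.growth
  let K : ℝ := -U (-l)
  have hK : 0 ≤ K := by
    have := hU.mono (show -l ≤ 0 by linarith)
    rw [hU.zero] at this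
    simp only [K]
    linarith
  let δ : ℝ := α / 2 / (1 + α)
  have hδ0 : 0 < δ := by positivity
  have hδ : (1 - δ) * (1 + α) = 1 + α / 2 := by
    simp only [δ]
    field_simp
    ring
  have hδ1 : δ < 1 := by
    rw [div_lt_one (by positivity)]
    linarith
  -- Below `z₀` the elasticity condition applies and the shift satisfies `b ≤ -δ (x - b)`.
  let z₀ : ℝ := min x₀ (-(l / δ))
  have hz₀ : z₀ ≤ 0 := (min_le_left _ _).trans hx₀
  have hUz₀ : U z₀ ≤ 0 := by
    rw [← hU.zero]
    exact hU.mono hz₀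
  refine ⟨1, 1 + α / 2, K + -U z₀, one_pos, by linarith, by linarith,
    fun b hb x t ht => ?_⟩
  have ht0 : 0 < t := by linarith
  have hlin : U (t * x - b) ≤ t * (U (x - b) + (K + -U z₀)) :=
    growth_linear hU.concave hU.mono hb (by change K ≤ _; linarith) (by linarith) x t ht
  refine ⟨by rwa [Real.rpow_one], ?_⟩
  have htq : t ≤ t ^ (1 + α / 2) := by
    simpa using Real.rpow_le_rpow_of_exponent_le ht (show (1 : ℝ) ≤ 1 + α / 2 by linarith)
  rcases le_or_gt 0 (U (x - b) + (K + -U z₀)) with h | h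
  · exact hlin.trans (mul_le_mul_of_nonneg_right htq h)
  · obtain ⟨hb1, hb2⟩ := abs_le.1 hb
    have hz : x - b < z₀ := by
      by_contra hcon
      have := hU.mono (not_lt.1 hcon)
      linarith
    have hzx₀ : x - b ≤ x₀ := hz.le.trans (min_le_left _ _)
    have hzl : δ * (x - b) ≤ -l := by
      have h1 : x - b ≤ -(l / δ) := hz.le.trans (min_le_right _ _)
      have h2 := mul_le_mul_of_nonneg_left h1 hδ0.le
      rwa [mul_neg, mul_div_cancel₀ _ hδ0.ne'] at h2
    -- The factor left after the shift is absorbed: `t x - b ≤ t' (x - b)`. Bernoulli's inequality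
    -- gives `t' ≥ t^(1-δ)`, and `δ` was chosen so that `(1-δ)(1+α) = 1 + α/2`.
    let t' : ℝ := 1 + (1 - δ) * (t - 1)
    have ht' : 1 ≤ t' := le_add_of_nonneg_right (mul_nonneg (by linarith) (by linarith))
    have h1 : t * x - b ≤ t' * (x - b) := by
      have h2 := mul_le_mul_of_nonneg_left (show b ≤ -(δ * (x - b)) by linarith) (sub_nonneg.2 ht)
      have h3 : t' * (x - b) = t * x - b - (t - 1) * b + (t - 1) * -(δ * (x - b)) := by
        simp only [t']
        ring
      linarith
    have h2 : t ^ (1 + α / 2) ≤ t' ^ (1 + α) := by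
      have h3 : t ^ (1 - δ) ≤ t' := by
        have := rpow_one_add_le_one_add_mul_self (s := t - 1) (p := 1 - δ) (by linarith)
          (by linarith) (by linarith)
        simpa [t'] using this
      rw [← hδ, Real.rpow_mul ht0.le]
      exact Real.rpow_le_rpow (by positivity) h3 (by positivity)
    have h3 : U (x - b) ≤ 0 := by linarith
    refine (hU.mono h1).trans ((hg _ hzx₀ t' ht').trans ?_)
    refine (mul_le_mul_of_nonpos_right h2 h3).trans ?_
    exact mul_le_mul_of_nonneg_left (by linarith) (by positivity)

theorem randomUtility_of_growth {Ω : Type*} {mΩ : MeasurableSpace Ω} {P : Measure Ω}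
    (hc : ConcaveOn ℝ Set.univ U) (hm : Monotone U) (hne : ∃ x, U x ≠ U 0)
    {B : Ω → ℝ} (hB : Measurable B) {l : ℝ} (hBl : ∀ᵐ ω ∂P, |B ω| ≤ l) {p q C : ℝ}
    (hg : ∀ b, |b| ≤ l → ∀ x t : ℝ, 1 ≤ t →
      U (t * x - b) ≤ t ^ p * (U (x - b) + C) ∧ U (t * x - b) ≤ t ^ q * (U (x - b) + C)) :
    RandomUtility P mΩ (fun x => U (x - l)) p q C (fun x ω => U (x - B ω)) where
  meas x := hm.measurable.comp (measurable_const.sub hB)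
  mono ω x y hxy := hm (by linarith)
  concave ω := by
    refine ⟨convex_univ, fun x _ y _ a b ha hb hab => ?_⟩
    have h := hc.2 (Set.mem_univ (x - B ω)) (Set.mem_univ (y - B ω)) ha hb hab
    have e : a • (x - B ω) + b • (y - B ω) = a • x + b • y - B ω := by
      simp only [smul_eq_mul]
      linear_combination (-B ω) * hab
    rwa [e] at h
  lower := by
    filter_upwards [hBl] with ω hω x
    exact hm (by linarith [(abs_le.1 hω).2])
  growth := by
    filter_upwards [hBl] with ω hω x t ht
    exact hg _ hω x t ht
  unbounded := ae_of_all _ fun ω => (tendsto_atBot_of_concaveOn hc hm hne).comp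
    (tendsto_atBot_add_const_right _ _ (tendsto_neg_atTop_atBot.comp tendsto_natCast_atTop_atTop))

end Growth
-- Backward induction and gluing of strategies
section DynamicProgramming

open Filter Topology

variable {Ω : Type*} {mΩ : MeasurableSpace Ω} {P : Measure Ω} {d T : ℕ} {F : Filtration ℕ mΩ}
  {S : ℕ → Ω → EuclideanSpace ℝ (Fin d)} {UT : ℝ → Ω → ℝ} {L : ℝ → ℝ} {p q C : ℝ}

theorem NoArbitrage.one_period (hNA : NoArbitrage P F T S) {t : ℕ} (ht : t < T)
    {ξ : Ω → EuclideanSpace ℝ (Fin d)} (hξ : Measurable[F t] ξ)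
    (h : ∀ᵐ ω ∂P, 0 ≤ inner ℝ (ξ ω) (S (t + 1) ω - S t ω)) :
    ∀ᵐ ω ∂P, inner ℝ (ξ ω) (S (t + 1) ω - S t ω) = 0 := by
  let φ : ℕ → Ω → EuclideanSpace ℝ (Fin d) := fun s => if s = t + 1 then ξ else 0
  have hφ : IsStrategy F T φ := by
    intro s _
    by_cases hs : s = t
    · subst hs
      simpa [φ] using hξ
    · have : φ (s + 1) = 0 := by simp [φ, hs]
      rw [this]
      exact measurable_const
  have hw : ∀ ω, wealth S 0 φ T ω = inner ℝ (ξ ω) (S (t + 1) ω - S t ω) := by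
    intro ω
    rw [wealth, zero_add, Finset.sum_eq_single_of_mem t (Finset.mem_range.2 ht)]
    · simp [φ, gain]
    · intro s _ hs
      simp [φ, hs, gain]
  simpa only [hw] using hNA φ hφ (by simpa only [hw] using h)

variable [IsProbabilityMeasure P]

/-- The one-period problem between `t` and `t + 1`. -/
theorem FiniteValueFunctions.onePeriod (hF : ∀ N : Set Ω, P N = 0 → MeasurableSet[F 0] N)
    (hS : ∀ t, t ≤ T → Measurable[F t] (S t)) (hNA : NoArbitrage P F T S)
    (hfin : FiniteValueFunctions P F S T UT) (hL : Continuous L) (hp : 0 < p) (hpq : p < q)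
    (hC : 0 ≤ C) {t : ℕ} (ht : t < T) {V : ℝ → Ω → ℝ}
    (hV : IsValueFunction P F S T UT (t + 1) V) (hVu : RandomUtility P mΩ L p q C V) :
    OnePeriod P (F t) (fun ω => S (t + 1) ω - S t ω) L p q C V where
  le := F.le t
  complete N hN := F.mono (Nat.zero_le t) _ (hF N hN)
  measY := ((hS (t + 1) ht).mono (F.le _) le_rfl).sub ((hS t ht.le).mono (F.le _) le_rfl)
  noArbitrage _ hξ h := hNA.one_period ht hξ h
  continuous_L := hL
  p_pos := hp
  p_lt_q := hpq
  C_nonneg := hC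
  utility := hVu
  finite y := by
    let ξ : Xi d F t := ⟨fun _ => y, measurable_const⟩
    obtain ⟨Z, ⟨-, hZ, -⟩, hZtop⟩ := hfin.finite t V ht hV 1
    -- If the positive part had infinite conditional expectation, well-definedness would make the
    -- generalized one `+∞`, above the finite essential supremum.
    filter_upwards [hfin.defined t V ht hV 1 ξ, hZ ξ, hZtop] with ω h1 h2 h3
    by_contra hcon
    have h4 : condLExp (F t) P (fun ω => ENNReal.ofReal (V (1 + gain S t (ξ.1 ω) ω) ω)) ω = ⊤ :=
      not_lt_top_iff.1 hcon
    have h5 := h1.resolve_left (not_not.2 h4)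
    refine absurd (h2.trans_lt h3) (not_lt.2 (le_of_eq ?_))
    rw [condValue, genCondExp, h4]
    lift condLExp (F t) P (fun ω => ENNReal.ofReal (-V (1 + gain S t (ξ.1 ω) ω) ω)) ω to NNReal
      using h5 with c hc
    simp

theorem OnePeriod.IsValue.isValueFunction {t : ℕ} {V W : ℝ → Ω → ℝ} (ht : t < T)
    (hV : IsValueFunction P F S T UT (t + 1) V)
    (h : OnePeriod P (F t) (fun ω => S (t + 1) ω - S t ω) L p q C V)
    (hW : IsValue P (F t) (fun ω => S (t + 1) ω - S t ω) V W) :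
    IsValueFunction P F S T UT t W := by
  refine .step ht hV (ae_of_all _ fun ω => ⟨hW.mono ω, hW.concave ω⟩) fun x => ⟨?_, ?_, ?_⟩
  · exact (measurable_coe_real_ereal).comp (hW.meas x)
  · intro ξ
    exact h.genCondExp_payoff_le hW (X := fun _ => x) measurable_const ξ.2
  · intro Z _ hZ
    obtain ⟨ξ, hξ, hξW⟩ := hW.attained (fun _ => x) measurable_const
    filter_upwards [hZ ⟨ξ, hξ.1⟩, genCondExp_eq_ce hξ.2, hξW] with ω h1 h2 h3
    rw [← h3, ← h2]
    exact h1

/-- The final wealth of a strategy started at time `t` with wealth `X`. -/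
noncomputable def terminalWealth (S : ℕ → Ω → EuclideanSpace ℝ (Fin d)) (T t : ℕ) (X : Ω → ℝ)
    (φ : ℕ → Ω → EuclideanSpace ℝ (Fin d)) (ω : Ω) : ℝ :=
  X ω + ∑ i ∈ Finset.Ico t T, gain S i (φ (i + 1) ω) ω

/-- `V` bounds the expected terminal utilities of strategies started at time `t`, and the bound
is attained. -/
structure IsDynamicValue (P : Measure Ω) (F : Filtration ℕ mΩ)
    (S : ℕ → Ω → EuclideanSpace ℝ (Fin d)) (T : ℕ) (UT : ℝ → Ω → ℝ) (t : ℕ)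
    (V : ℝ → Ω → ℝ) : Prop where
  lintegral_neg : ∀ φ, IsStrategy F T φ → ∀ X : Ω → ℝ, Measurable[F t] X →
    ∫⁻ ω, ENNReal.ofReal (-UT (terminalWealth S T t X φ ω) ω) ∂P ≠ ⊤ →
    ∫⁻ ω, ENNReal.ofReal (-V (X ω) ω) ∂P ≠ ⊤
  integral_le : ∀ φ, IsStrategy F T φ → ∀ X : Ω → ℝ, Measurable[F t] X →
    ∫⁻ ω, ENNReal.ofReal (-UT (terminalWealth S T t X φ ω) ω) ∂P ≠ ⊤ →
    Integrable (fun ω => V (X ω) ω) P →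
    Integrable (fun ω => UT (terminalWealth S T t X φ ω) ω) P ∧
      ∫ ω, UT (terminalWealth S T t X φ ω) ω ∂P ≤ ∫ ω, V (X ω) ω ∂P
  attained : ∀ X : Ω → ℝ, Measurable[F t] X → Integrable (fun ω => V (X ω) ω) P →
    Integrable (V 0) P → ∃ φ, IsStrategy F T φ ∧
      Integrable (fun ω => UT (terminalWealth S T t X φ ω) ω) P ∧
      ∫ ω, UT (terminalWealth S T t X φ ω) ω ∂P = ∫ ω, V (X ω) ω ∂P

theorem isDynamicValue_terminal : IsDynamicValue P F S T UT T UT where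
  lintegral_neg φ _ X _ h := by simpa [terminalWealth] using h
  integral_le φ _ X _ _ h := by simpa [terminalWealth] using h
  attained X _ h _ := ⟨0, fun _ _ => measurable_const, by simpa [terminalWealth] using h⟩

theorem terminalWealth_succ {t : ℕ} (ht : t < T) (X : Ω → ℝ)
    (φ : ℕ → Ω → EuclideanSpace ℝ (Fin d)) :
    terminalWealth S T t X φ =
      terminalWealth S T (t + 1) (fun ω => X ω + gain S t (φ (t + 1) ω) ω) φ := by
  ext ω
  rw [terminalWealth, terminalWealth, Finset.sum_eq_sum_Ico_succ_bot ht, add_assoc]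

/-- Integrability of negative parts travels backwards from the terminal date, and integrability of
the value then travels forwards. An optimizer is one optimal position followed by a strategy that
attains the next value. -/
theorem IsDynamicValue.step (hS : ∀ t, t ≤ T → Measurable[F t] (S t)) {t : ℕ} {V W : ℝ → Ω → ℝ}
    (ht : t < T) (h : OnePeriod P (F t) (fun ω => S (t + 1) ω - S t ω) L p q C V)
    (hW : OnePeriod.IsValue P (F t) (fun ω => S (t + 1) ω - S t ω) V W)
    (hV : IsDynamicValue P F S T UT (t + 1) V) : IsDynamicValue P F S T UT t W := by
  have hmono : F t ≤ F (t + 1) := F.mono (Nat.le_succ t)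
  have hXm : ∀ {X : Ω → ℝ} {ξ : Ω → EuclideanSpace ℝ (Fin d)}, Measurable[F t] X →
      Measurable[F t] ξ → Measurable[F (t + 1)] fun ω => X ω + gain S t (ξ ω) ω := by
    intro X ξ hX hξ
    exact Measurable.add (hX.mono hmono le_rfl) (Measurable.inner (hξ.mono hmono le_rfl)
      (Measurable.sub (hS (t + 1) ht) ((hS t ht.le).mono hmono le_rfl)))
  refine ⟨fun φ hφ X hX hneg => ?_, fun φ hφ X hX hneg hint => ?_, fun X hX hint hint0 => ?_⟩
  · rw [terminalWealth_succ ht] at hneg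
    exact (h.lintegral_neg_value_ne_top hW hX (hφ t ht)
      (hV.lintegral_neg φ hφ _ (hXm hX (hφ t ht)) hneg)).2
  · rw [terminalWealth_succ ht] at hneg ⊢
    obtain ⟨h1, h2⟩ := h.integrable_payoff_of_value hW hX (hφ t ht)
      (hV.lintegral_neg φ hφ _ (hXm hX (hφ t ht)) hneg) hint
    obtain ⟨h3, h4⟩ := hV.integral_le φ hφ _ (hXm hX (hφ t ht)) hneg h1
    exact ⟨h3, h4.trans h2⟩
  · obtain ⟨ξ, hξ, hξW⟩ := hW.attained X hX
    obtain ⟨h1, h2⟩ := h.integrable_payoff_of_optimal hW hX hξ hξW hint hint0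
    obtain ⟨φ, hφ, h3, h4⟩ := hV.attained (fun ω => X ω + gain S t (ξ ω) ω) (hXm hX hξ.1) h1
      (h.integrable_zero hW hint0)
    let ψ : ℕ → Ω → EuclideanSpace ℝ (Fin d) := Function.update φ (t + 1) ξ
    have hψ : terminalWealth S T t X ψ =
        terminalWealth S T (t + 1) (fun ω => X ω + gain S t (ξ ω) ω) φ := by
      rw [terminalWealth_succ ht]
      ext ω
      simp only [terminalWealth, ψ, Function.update_self]
      congr 1
      refine Finset.sum_congr rfl fun i hi => ?_
      have : i + 1 ≠ t + 1 := by
        have := (Finset.mem_Ico.1 hi).1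
        omega
      rw [Function.update_of_ne this]
    refine ⟨ψ, fun s hs => ?_, ?_⟩
    · by_cases hst : s = t
      · subst hst
        simpa [ψ] using hξ.1
      · simpa [ψ, hst] using hφ s hs
    · rw [hψ]
      exact ⟨h3, h4.trans h2⟩

theorem exists_isDynamicValue (hF : ∀ N : Set Ω, P N = 0 → MeasurableSet[F 0] N)
    (hS : ∀ t, t ≤ T → Measurable[F t] (S t)) (hNA : NoArbitrage P F T S)
    (hfin : FiniteValueFunctions P F S T UT) (hL : Continuous L) (hp : 0 < p) (hpq : p < q)
    (hC : 0 ≤ C) (hUT : RandomUtility P mΩ L p q C UT) {t : ℕ} (ht : t ≤ T) :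
    ∃ V, IsValueFunction P F S T UT t V ∧ RandomUtility P mΩ L p q C V ∧
      IsDynamicValue P F S T UT t V := by
  induction ht using Nat.decreasingInduction with
  | self => exact ⟨UT, .terminal, hUT, isDynamicValue_terminal⟩
  | of_succ t ht ih =>
    obtain ⟨V, hV, hVu, hVd⟩ := ih
    have h := hfin.onePeriod hF hS hNA hL hp hpq hC ht hV hVu
    obtain ⟨W, hW⟩ := h.exists_isValue
    have hWu := hW.randomUtility h
    exact ⟨W, hW.isValueFunction ht hV h,
      { hWu with meas := fun x => (hWu.meas x).mono (F.le t) le_rfl }, hVd.step hS ht h hW⟩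

theorem genExp_of_integrable {f : Ω → ℝ} (hf : Integrable f P) :
    genExp P f = ((∫ ω, f ω ∂P : ℝ) : EReal) := by
  have h1 := lintegral_ofReal_ne_top_of_integrable hf
  have h2 : ∫⁻ ω, ENNReal.ofReal (-f ω) ∂P ≠ ⊤ := lintegral_ofReal_ne_top_of_integrable hf.neg
  rw [integral_eq_lintegral_pos_part_sub_lintegral_neg_part hf, EReal.coe_sub,
    EReal.coe_ennreal_toReal h1, EReal.coe_ennreal_toReal h2]
  rfl

theorem integrable_of_genExp_lt_top {f : Ω → ℝ} (hf : Measurable f)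
    (hlt : genExp P f < ⊤) {a : ℝ} (ha : ∀ᵐ ω ∂P, a ≤ f ω) : Integrable f P := by
  have h2 : ∫⁻ ω, ENNReal.ofReal (-f ω) ∂P ≠ ⊤ := by
    refine ne_top_of_le_ne_top (b := ∫⁻ ω, ENNReal.ofReal (-a) ∂P) (by simp) (lintegral_mono_ae ?_)
    filter_upwards [ha] with ω hω using ENNReal.ofReal_le_ofReal (neg_le_neg hω)
  refine integrable_of_lintegral_ne_top hf (fun h1 => ?_) h2
  refine absurd hlt (not_lt.2 (le_of_eq ?_))
  rw [genExp, h1]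
  lift ∫⁻ ω, ENNReal.ofReal (-f ω) ∂P to NNReal using h2 with c hc
  simp

theorem optimal_of_bound {U : ℝ → ℝ} {c : ℝ} {B : Ω → ℝ} {v : ℝ}
    (hle : ∀ φ ∈ admissible P F S T U c B,
      genExp P (fun ω => U (wealth S c φ T ω - B ω)) ≤ (v : EReal))
    (hex : ∃ φ ∈ admissible P F S T U c B,
      genExp P (fun ω => U (wealth S c φ T ω - B ω)) = (v : EReal)) :
    ⊥ < optimalValue P F S T U c B ∧ optimalValue P F S T U c B < ⊤ ∧
      ∃ φ ∈ admissible P F S T U c B,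
        genExp P (fun ω => U (wealth S c φ T ω - B ω)) = optimalValue P F S T U c B := by
  have hv : optimalValue P F S T U c B = (v : EReal) := by
    refine le_antisymm (iSup₂_le hle) ?_
    obtain ⟨φ, hφ, he⟩ := hex
    rw [← he]
    exact le_iSup₂ (f := fun φ _ => genExp P (fun ω => U (wealth S c φ T ω - B ω))) φ hφ
  rw [hv]
  exact ⟨EReal.bot_lt_coe v, EReal.coe_lt_top v, hex⟩

end DynamicProgramming

end UtilityMax

theorem theorem2p10 {Ω : Type*} {mΩ : MeasurableSpace Ω} (P : Measure Ω) [IsProbabilityMeasure P]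
    (d T : ℕ) (F : Filtration ℕ mΩ)
    (hF : ∀ N : Set Ω, P N = 0 → MeasurableSet[F 0] N)
    (S : ℕ → Ω → EuclideanSpace ℝ (Fin d)) (hS : ∀ t, t ≤ T → Measurable[F t] (S t))
    (hNA : UtilityMax.NoArbitrage P F T S)
    (U : ℝ → ℝ) (hU : UtilityMax.ElasticAtTop U ∨ UtilityMax.ElasticAtBot U)
    (B : Ω → ℝ) (hB : Measurable B) (hBbdd : ∃ l : ℝ, ∀ᵐ ω ∂P, |B ω| ≤ l)
    (hfin : UtilityMax.FiniteValueFunctions P F S T (fun x ω => U (x - B ω))) (c : ℝ) :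
    ⊥ < UtilityMax.optimalValue P F S T U c B ∧
      UtilityMax.optimalValue P F S T U c B < ⊤ ∧
      ∃ φ ∈ UtilityMax.admissible P F S T U c B,
        UtilityMax.genExp P (fun ω => U (UtilityMax.wealth S c φ T ω - B ω)) =
          UtilityMax.optimalValue P F S T U c B := by
  open UtilityMax in
  have hconc : ConcaveOn ℝ Set.univ U := hU.elim (·.concave) (·.concave)
  have hmono : Monotone U := hU.elim (·.mono) (·.mono)
  have hzero : U 0 = 0 := hU.elim (·.zero) (·.zero)
  -- Only a nonconstant utility tends to `-∞`; for a constant one every strategy is optimal with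
  -- value zero.
  by_cases hne : ∃ x, U x ≠ U 0
  · obtain ⟨l, hl⟩ := hBbdd
    have hl0 : 0 ≤ l := by
      obtain ⟨ω, hω⟩ := hl.exists
      exact (abs_nonneg _).trans hω
    obtain ⟨p, q, C, hp, hpq, hC, hg⟩ := hU.elim (·.exists_growth hl0) (·.exists_growth hl0)
    obtain ⟨V, hV, hVu, hVd⟩ := exists_isDynamicValue hF hS hNA hfin
      (L := fun x => U (x - l))
      ((continuous_of_concaveOn_univ hconc).comp (continuous_id.sub continuous_const)) hp hpq hC
      (randomUtility_of_growth hconc hmono hne hB hl hg) (Nat.zero_le T)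
    -- The upper side is the assumption `E U_0(x) < ∞`; the lower side is the inherited bound `U(x -
    -- l)`.
    have hVi : ∀ x, Integrable (V x) P := fun x =>
      integrable_of_genExp_lt_top (hVu.meas x) (hfin.initial V hV x).2
        (hVu.lower.mono fun ω hω => hω x)
    have hw : ∀ φ ω, wealth S c φ T ω = terminalWealth S T 0 (fun _ => c) φ ω := fun φ ω => by
      rw [wealth, terminalWealth, Finset.range_eq_Ico]
    refine optimal_of_bound (v := ∫ ω, V c ω ∂P) (fun φ hφ => ?_) ?_
    -- An infinite negative part makes the expectation `-∞`, because admissibility keeps the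
    -- positive part finite.
    · by_cases hneg : ∫⁻ ω, ENNReal.ofReal (-U (wealth S c φ T ω - B ω)) ∂P = ⊤
      · have hpos := hφ.2.resolve_right (not_not.2 hneg)
        rw [genExp, hneg]
        lift ∫⁻ ω, ENNReal.ofReal (U (wealth S c φ T ω - B ω)) ∂P to NNReal using hpos with a ha
        simp
      · simp only [hw] at hneg ⊢
        obtain ⟨h1, h2⟩ := hVd.integral_le φ hφ.1 (fun _ => c) measurable_const hneg (hVi c)
        rw [genExp_of_integrable h1]
        exact_mod_cast h2
    · obtain ⟨φ, hφ, h1, h2⟩ := hVd.attained (fun _ => c) measurable_const (hVi c) (hVi 0)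
      simp only [← hw] at h1 h2
      refine ⟨φ, ⟨hφ, Or.inl (lintegral_ofReal_ne_top_of_integrable h1)⟩, ?_⟩
      rw [genExp_of_integrable h1, h2]
  · push Not at hne
    have h0 : ∀ x, U x = 0 := fun x => (hne x).trans hzero
    have hgen : ∀ φ, genExp P (fun ω => U (wealth S c φ T ω - B ω)) = ((0 : ℝ) : EReal) := by
      intro φ
      simp [genExp, h0]
    exact optimal_of_bound (v := 0) (fun φ _ => (hgen φ).le)
      ⟨0, ⟨fun _ _ => measurable_const, Or.inl (by simp [h0])⟩, hgen 0⟩
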